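/- Let $N\ge 2$ be an integer, $0<T<\infty$ and $\nu\ge 0$. Let $L^2_\sigma(\mathbb R^N)$ be the space of vector fields in $[L^2(\mathbb R^N)]^N$ whose divergence vanishes in the sense of distributions, let $\mathcal S(\mathbb R^N)$ be the Schwartz space with dual $\mathcal S'(\mathbb R^N)$ and pairing $\langle\cdot,\cdot\rangle$, and let $p\in L^1(0,T;\mathcal S'(\mathbb R^N))$ mean that $t\mapsto\langle p(t),\psi\rangle$ is integrable on $(0,T)$ for every $\psi\in\mathcal S(\mathbb R^N)$. A pair $(v,p)\in L^1(0,T;L^2_\sigma(\mathbb R^N))\times L^1(0,T;\mathcal S'(\mathbb R^N))$ is called a weak solution of the Navier–Stokes equations with viscosity $\nu$ (of the Euler equations if $\nu=0$) on $\mathbb R^N\times(0,T)$ if for all $\phi\in[C_0^\infty(\mathbb R^N)]^N$ and all $\xi\in C^1_0(0,T)$ (compactly supported in $(0,T)$) the function $t\mapsto \xi(t)\int_{\mathbb R^N} v(x,t)\otimes v(x,t):\nabla\phi(x)\,dx$ is integrable on $(0,T)$ and $$-\int_0^T\!\!\int_{\mathbb R^N} v\cdot\phi\,\xi'(t)\,dx\,dt-\int_0^T\!\!\int_{\mathbb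 R^N} v\otimes v:\nabla\phi\,\xi(t)\,dx\,dt=\int_0^T\langle p(t),\operatorname{div}\phi\rangle\,\xi(t)\,dt+\nu\int_0^T\!\!\int_{\mathbb R^N} v\cdot\Delta\phi\,\xi(t)\,dx\,dt .$$ Fix $\varphi\in\mathcal S(\mathbb R^N)$ real-valued with $\int_{\mathbb R^N}\varphi\,dx\ne 0$, and set $\varphi_s(x)=s^{-N}\varphi(s^{-1}x)$ for $s>0$. For $0<q\le 1$ let $\mathcal H^q(\mathbb R^N)$ be the Hardy space of those $f\in\mathcal S'(\mathbb R^N)$ for which $\mathcal M_\varphi f(x):=\sup_{s>0}|f*\varphi_s(x)|$ belongs to $L^q(\mathbb R^N)$, with $\|f\|_{\mathcal H^q}:=\|\mathcal M_\varphi f\|_{L^q}$. Theorem 1.1. Let $(v,p)$ be a weak solution of the Navier–Stokes equations ($\nu>0$) or the Euler equations ($\nu=0$) on $\mathbb R^N\times(0,T)$. (i) (Liouville property) Suppose that either $p\in L^1(0,T;L^1(\mathbb R^N))$ with $\int_{\mathbb R^N}p(x,t)\,dx\ge 0$ for a.e. $t\in(0,T)$, or $p\in L^1(0,T;\mathcal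 H^q(\mathbb R^N))$ for some $q\in(0,1]$. Then $v(x,t)=0$ for a.e. $(x,t)\in\mathbb R^N\times(0,T)$. (ii) (Equipartition of energy) Suppose that $p\in L^1(0,T;L^1(\mathbb R^N))$ with $\int_{\mathbb R^N}p(x,t)\,dx\le 0$ for a.e. $t\in(0,T)$. Then for a.e. $t\in(0,T)$ $$\frac12\int_{\mathbb R^N}(v^j(x,t))^2\,dx=-\frac12\int_{\mathbb R^N}p(x,t)\,dx\quad\text{for all } j\in\{1,\dots,N\},$$ and $\int_{\mathbb R^N}v^j(x,t)\,v^k(x,t)\,dx=0$ for all $j,k\in\{1,\dots,N\}$ with $j\neq k$. -/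

import Mathlib

open MeasureTheory Set
open scoped ENNReal SchwartzMap LineDeriv

namespace NavierStokes

noncomputable section

/-- The Euclidean space `ℝ^N`. -/
abbrev Space (N : ℕ) : Type := EuclideanSpace ℝ (Fin N)

/-- Real tempered distributions on `ℝ^N`: continuous linear functionals on the Schwartz space. -/
abbrev Tempered (N : ℕ) : Type := 𝓢(Space N, ℝ) →L[ℝ] ℝ

/-- Lebesgue measure on `(0, T)`. -/
def timeMeasure (T : ℝ) : Measure ℝ := volume.restrict (Ioo 0 T)

/-- The partial derivative `∂_i f` of a Schwartz function, again a Schwartz function. -/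
def pd {N : ℕ} (i : Fin N) (f : 𝓢(Space N, ℝ)) : 𝓢(Space N, ℝ) :=
  ∂_{(EuclideanSpace.single i (1 : ℝ) : Space N)} f

/-- The divergence `∑ i, ∂_i φ^i` of a vector field with Schwartz components. -/
def divergence {N : ℕ} (φ : Fin N → 𝓢(Space N, ℝ)) : 𝓢(Space N, ℝ) :=
  ∑ i, pd i (φ i)

/-- The Laplacian `∑ i, ∂_i ∂_i f`. -/
def lap {N : ℕ} (f : 𝓢(Space N, ℝ)) : 𝓢(Space N, ℝ) :=
  ∑ i, pd i (pd i f)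

/-- `f ∈ L¹(0,T; L^q(ℝ^N; F))`, for a function `f = f(t)(x)` of time and space. -/
def MemL1Lq {N : ℕ} {F : Type*} [NormedAddCommGroup F] (T : ℝ) (q : ℝ≥0∞)
    (f : ℝ → Space N → F) : Prop :=
  AEStronglyMeasurable (Function.uncurry f) ((timeMeasure T).prod volume) ∧
    ∫⁻ t, eLpNorm (f t) q volume ∂(timeMeasure T) < ∞

/-- `div u = 0` in the sense of distributions. The functions in `C_0^∞(ℝ^N)` are exactly the
Schwartz functions with compact support. -/
def IsDivFree {N : ℕ} (u : Space N → Space N) : Prop :=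
  ∀ ψ : 𝓢(Space N, ℝ), HasCompactSupport ψ → (∫ x, ∑ i, u x i * pd i ψ x) = 0

/-- `p ∈ L¹(0,T; 𝓢'(ℝ^N))`: every pairing `t ↦ ⟨p(t), ψ⟩` is integrable on `(0,T)`. -/
def MemL1Tempered {N : ℕ} (T : ℝ) (p : ℝ → Tempered N) : Prop :=
  ∀ ψ : 𝓢(Space N, ℝ), Integrable (fun t => p t ψ) (timeMeasure T)

/-- Weak solutions `(v, p)` of the Navier–Stokes equations with viscosity `ν` (the Euler equations
if `ν = 0`) on `ℝ^N × (0,T)`. The test functions are `φ ∈ [C_0^∞(ℝ^N)]^N` and `ξ ∈ C_0^1(0,T)`.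
The quadratic term need not be integrable in time for `v ∈ L¹(0,T; L²)`, so its integrability is
required here; the other three integrals in the weak formulation always exist. -/
structure IsWeakSolution {N : ℕ} (ν T : ℝ) (v : ℝ → Space N → Space N) (p : ℝ → Tempered N) :
    Prop where
  memL1L2 : MemL1Lq T 2 v
  divFree : ∀ᵐ t ∂(timeMeasure T), IsDivFree (v t)
  pressure : MemL1Tempered T p
  integrable_quadratic : ∀ (φ : Fin N → 𝓢(Space N, ℝ)) (ξ : ℝ → ℝ),
    (∀ j, HasCompactSupport (φ j)) →
    ContDiff ℝ 1 ξ → HasCompactSupport ξ → tsupport ξ ⊆ Ioo 0 T →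
    Integrable (fun t => (∫ x, ∑ i, ∑ j, v t x i * v t x j * pd i (φ j) x) * ξ t) (timeMeasure T)
  weak_formulation : ∀ (φ : Fin N → 𝓢(Space N, ℝ)) (ξ : ℝ → ℝ),
    (∀ j, HasCompactSupport (φ j)) →
    ContDiff ℝ 1 ξ → HasCompactSupport ξ → tsupport ξ ⊆ Ioo 0 T →
    - (∫ t, (∫ x, ∑ j, v t x j * φ j x) * deriv ξ t ∂(timeMeasure T))
      - ∫ t, (∫ x, ∑ i, ∑ j, v t x i * v t x j * pd i (φ j) x) * ξ t ∂(timeMeasure T)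
    = (∫ t, p t (divergence φ) * ξ t ∂(timeMeasure T))
      + ν * ∫ t, (∫ x, ∑ j, v t x j * lap (φ j) x) * ξ t ∂(timeMeasure T)

/-- The `j`-th component `½ ∫ (v^j(x,t))² dx` of the energy at time `t`. -/
def energy {N : ℕ} (v : ℝ → Space N → Space N) (j : Fin N) (t : ℝ) : ℝ :=
  (1 / 2) * ∫ x, (v t x j) ^ 2

/-- `p ∈ L¹(0,T; L¹(ℝ^N))`, and `p` is given by the function `P = P(t)(x)`. -/
def IsL1L1Density {N : ℕ} (T : ℝ) (p : ℝ → Tempered N) (P : ℝ → Space N → ℝ) : Prop :=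
  MemL1Lq T 1 P ∧
    ∀ᵐ t ∂(timeMeasure T), ∀ ψ : 𝓢(Space N, ℝ), p t ψ = ∫ x, P t x * ψ x

/-- The Schwartz function `y ↦ φ_s(x - y)`, where `φ_s(z) = s^{-N} φ(s⁻¹ z)` and `s > 0`. -/
def dilatedKernel {N : ℕ} (φ : 𝓢(Space N, ℝ)) (s : ℝ) (hs : 0 < s) (x : Space N) :
    𝓢(Space N, ℝ) :=
  (s ^ N)⁻¹ • SchwartzMap.compSubConstCLM ℝ x
    (SchwartzMap.compCLMOfContinuousLinearEquiv ℝ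
      (ContinuousLinearEquiv.smulLeft
        (Units.mk0 (-s⁻¹) (neg_ne_zero.mpr (inv_ne_zero hs.ne')))) φ)

theorem dilatedKernel_apply {N : ℕ} (φ : 𝓢(Space N, ℝ)) (s : ℝ) (hs : 0 < s) (x y : Space N) :
    dilatedKernel φ s hs x y = (s ^ N)⁻¹ * φ (s⁻¹ • (x - y)) := by
  have h : (-s⁻¹) • (y - x) = s⁻¹ • (x - y) := by rw [neg_smul, ← smul_neg, neg_sub]
  rw [← h]
  rfl

/-- The maximal function `𝓜_φ f(x) = sup_{s > 0} |(f * φ_s)(x)|` of a tempered distribution, where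
`(f * φ_s)(x) = ⟨f, φ_s(x - ·)⟩`. -/
def maximalFunction {N : ℕ} (φ : 𝓢(Space N, ℝ)) (f : Tempered N) (x : Space N) : ℝ≥0∞ :=
  ⨆ (s : ℝ) (hs : 0 < s), ENNReal.ofReal |f (dilatedKernel φ s hs x)|

/-- The Hardy quasi-norm `‖f‖_{𝓗^q} = ‖𝓜_φ f‖_{L^q}`. -/
def hardyNorm {N : ℕ} (φ : 𝓢(Space N, ℝ)) (q : ℝ) (f : Tempered N) : ℝ≥0∞ :=
  (∫⁻ x, maximalFunction φ f x ^ q) ^ (1 / q)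

/-- The Hardy space `𝓗^q(ℝ^N)`, defined with the Schwartz function `φ`. -/
def hardySpace {N : ℕ} (φ : 𝓢(Space N, ℝ)) (q : ℝ) : Set (Tempered N) :=
  {f | hardyNorm φ q f < ∞}

/-- `p ∈ L¹(0,T; 𝓗^q(ℝ^N))`. -/
def MemL1Hardy {N : ℕ} (φ : 𝓢(Space N, ℝ)) (q T : ℝ) (p : ℝ → Tempered N) : Prop :=
  MemL1Tempered T p ∧ (∀ᵐ t ∂(timeMeasure T), p t ∈ hardySpace φ q) ∧
    ∫⁻ t, hardyNorm φ q (p t) ∂(timeMeasure T) < ∞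

end

end NavierStokes

open NavierStokes

/-! Testing the weak formulation with a gradient `φ = ∇ψ` removes both the time derivative and the
viscous term, since `v` is divergence free and `Δ∇ψ = ∇Δψ`. What remains, for each `ψ` and almost
every `t`, is the pressure equation `∑ ∫ v_i v_j ∂_i∂_j ψ = -⟨p, Δψ⟩` (`ae_hessPairing_eq`). The
exceptional null set depends on `ψ`, so only countably many test functions are used. Write `c_ij = ∫
v_i v_j` at a fixed time.

The matrix `c` is read off at large scales. For `ψ(x/s)` both sides carry a factor `s⁻²`; after
removing it, dominated convergence as `s → ∞` freezes `ψ` at the origin. If `p(t)` has an integrable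
density `P`, this gives `∑ c_ij ∂_i∂_j ψ(0) = -(∫ P) Δψ(0)`, and `ψ = x_k x_l` near `0` yields `c_kl
= -δ_kl ∫ P` (`ae_stress_eq_pressure`). This is equipartition; if moreover `∫ P ≥ 0`, then `c_kk ≤
0`, so `v = 0`.

If `f = p(t)` lies in a Hardy space, put `θ = φ(-·)` and `u_s(x) = s^N (f * φ_s)(s x)`, with `s = n
+ 1`. The pressure equation bounds `Δu_s` uniformly and shows that it converges pointwise to `-∑
c_ij (∂_i∂_j θ)(-x)`. The maximal function controls `u_s` in `L^q`, uniformly in `s`, and away from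
the origin the `L^q` norm tends to `0`. A mean value inequality with the Hardy–Littlewood absorption
argument turns these bounds into a uniform `L^∞` bound (`exists_sup_bound`), so `u_s → 0` in `L¹`
away from the origin even when `q < 1`. Hence the limit of `Δu_s` vanishes off the origin, that is
`∑ c_ij ∂_i∂_j θ = 0` almost everywhere. As `∫ θ ≠ 0`, second moments force `c_kk = 0`
(`diag_eq_zero_of_hessComb_eq_zero`), and again `v = 0`. -/

open Filter Topology

namespace NavierStokes

noncomputable section

variable {N : ℕ}

/-! ### Dilations, translations and derivatives of Schwartz functions -/

/-- The dilation `ψ ↦ ψ(c ·)` of Schwartz functions. -/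
def dil (c : ℝ) (hc : c ≠ 0) : 𝓢(Space N, ℝ) →L[ℝ] 𝓢(Space N, ℝ) :=
  SchwartzMap.compCLMOfContinuousLinearEquiv ℝ
    (ContinuousLinearEquiv.smulLeft (Units.mk0 c hc))

@[simp]
theorem dil_apply (c : ℝ) (hc : c ≠ 0) (ψ : 𝓢(Space N, ℝ)) (x : Space N) :
    dil c hc ψ x = ψ (c • x) := rfl

theorem pd_dil (c : ℝ) (hc : c ≠ 0) (i : Fin N) (ψ : 𝓢(Space N, ℝ)) :
    pd i (dil c hc ψ) = c • dil c hc (pd i ψ) := by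
  have h : ((ContinuousLinearEquiv.smulLeft (Units.mk0 c hc) : Space N ≃L[ℝ] Space N)
      (EuclideanSpace.single i (1 : ℝ))) = c • EuclideanSpace.single i (1 : ℝ) := rfl
  unfold pd dil
  rw [SchwartzMap.lineDerivOp_compCLMOfContinuousLinearEquiv, h, LineDeriv.lineDerivOp_left_smul,
    map_smul]

theorem pd_apply (i : Fin N) (ψ : 𝓢(Space N, ℝ)) (x : Space N) :
    pd i ψ x = fderiv ℝ ψ x (EuclideanSpace.single i 1) :=
  SchwartzMap.lineDerivOp_apply_eq_fderiv _ _ _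

theorem pd_smul (i : Fin N) (c : ℝ) (f : 𝓢(Space N, ℝ)) : pd i (c • f) = c • pd i f :=
  LineDeriv.lineDerivOp_smul _ _ _

theorem pd_sum {ι : Type*} (s : Finset ι) (i : Fin N) (f : ι → 𝓢(Space N, ℝ)) :
    pd i (∑ a ∈ s, f a) = ∑ a ∈ s, pd i (f a) :=
  map_sum (LineDeriv.lineDerivOpCLM ℝ 𝓢(Space N, ℝ) (EuclideanSpace.single i (1 : ℝ))) f s

theorem continuous_pd (i : Fin N) : Continuous (pd i : 𝓢(Space N, ℝ) → 𝓢(Space N, ℝ)) :=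
  (LineDeriv.lineDerivOpCLM ℝ 𝓢(Space N, ℝ) (EuclideanSpace.single i (1 : ℝ))).continuous

theorem continuous_lap : Continuous (lap : 𝓢(Space N, ℝ) → 𝓢(Space N, ℝ)) :=
  continuous_finsetSum _ fun i _ => (continuous_pd i).comp (continuous_pd i)

theorem pd_comm (i j : Fin N) (ψ : 𝓢(Space N, ℝ)) : pd i (pd j ψ) = pd j (pd i ψ) := by
  ext x
  have key : ∀ a b : Fin N, pd a (pd b ψ) x =
      fderiv ℝ (fderiv ℝ ψ) x (EuclideanSpace.single a 1) (EuclideanSpace.single b 1) := by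
    intro a b
    rw [pd_apply]
    have h : (pd b ψ : Space N → ℝ) = fun y => fderiv ℝ ψ y (EuclideanSpace.single b 1) := by
      funext y; exact pd_apply _ _ _
    have hd : DifferentiableAt ℝ (fderiv ℝ ψ) x :=
      ((ψ.smooth 2).fderiv_right (m := 1) (by norm_num)).differentiable (by norm_num) x
    rw [h, fderiv_clm_apply hd (differentiableAt_const _)]
    simp
  rw [key, key]
  exact ((ψ.smooth 2).contDiffAt.isSymmSndFDerivAt (by simp)) _ _

theorem lap_pd (j : Fin N) (ψ : 𝓢(Space N, ℝ)) : lap (pd j ψ) = pd j (lap ψ) := by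
  unfold lap
  rw [pd_sum]
  refine Finset.sum_congr rfl fun i _ => ?_
  rw [pd_comm i j ψ, pd_comm i j]

theorem hasCompactSupport_pd {ψ : 𝓢(Space N, ℝ)} (h : HasCompactSupport ψ) (i : Fin N) :
    HasCompactSupport (pd i ψ) :=
  h.of_isClosed_subset (isClosed_tsupport _) (SchwartzMap.tsupport_lineDerivOp_subset _ _)

theorem hasCompactSupport_sum {ι : Type*} (s : Finset ι) (f : ι → 𝓢(Space N, ℝ))
    (h : ∀ a ∈ s, HasCompactSupport (f a)) : HasCompactSupport (∑ a ∈ s, f a : 𝓢(Space N, ℝ)) := by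
  classical
  induction s using Finset.induction_on with
  | empty => simpa using HasCompactSupport.zero
  | insert a s ha ih =>
    rw [Finset.sum_insert ha]
    exact (h a (by simp)).add (ih fun b hb => h b (by simp [hb]))

theorem hasCompactSupport_lap {ψ : 𝓢(Space N, ℝ)} (h : HasCompactSupport ψ) :
    HasCompactSupport (lap ψ) :=
  hasCompactSupport_sum _ _ fun i _ => hasCompactSupport_pd (hasCompactSupport_pd h i) i

theorem hasCompactSupport_dil {ψ : 𝓢(Space N, ℝ)} (h : HasCompactSupport ψ) (c : ℝ) (hc : c ≠ 0) :
    HasCompactSupport (dil c hc ψ) :=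
  h.comp_homeomorph (ContinuousLinearEquiv.smulLeft (R₁ := ℝ) (M₁ := Space N)
    (Units.mk0 c hc)).toHomeomorph

theorem pd_compSubConst (i : Fin N) (a : Space N) (ψ : 𝓢(Space N, ℝ)) :
    pd i (SchwartzMap.compSubConstCLM ℝ a ψ) = SchwartzMap.compSubConstCLM ℝ a (pd i ψ) := by
  ext x
  rw [pd_apply, SchwartzMap.compSubConstCLM_apply, pd_apply]
  have : (SchwartzMap.compSubConstCLM ℝ a ψ : Space N → ℝ) = fun y => ψ (y - a) := rfl
  rw [this, fderiv_comp_sub]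

theorem lap_compSubConst (a : Space N) (ψ : 𝓢(Space N, ℝ)) :
    lap (SchwartzMap.compSubConstCLM ℝ a ψ) = SchwartzMap.compSubConstCLM ℝ a (lap ψ) := by
  simp only [lap, pd_compSubConst, map_sum]

theorem pd_pd_dil (c : ℝ) (hc : c ≠ 0) (i j : Fin N) (ψ : 𝓢(Space N, ℝ)) :
    pd i (pd j (dil c hc ψ)) = c ^ 2 • dil c hc (pd i (pd j ψ)) := by
  rw [pd_dil, pd_smul, pd_dil, smul_smul, sq]

theorem lap_dil (c : ℝ) (hc : c ≠ 0) (ψ : 𝓢(Space N, ℝ)) :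
    lap (dil c hc ψ) = c ^ 2 • dil c hc (lap ψ) := by
  simp only [lap, pd_pd_dil, map_sum, Finset.smul_sum]

/-! ### Compactly supported functions are dense in the Schwartz space -/

/-- Each derivative of a dilation by `c` brings out a factor `c`, so widening the cut-off does not
increase its derivatives. -/
theorem norm_iteratedFDeriv_dil_le (χ : 𝓢(Space N, ℝ)) (c : ℝ) (hc : c ≠ 0) (hc1 : |c| ≤ 1) (i : ℕ)
    (x : Space N) :
    ‖iteratedFDeriv ℝ i (dil c hc χ) x‖ ≤ SchwartzMap.seminorm ℝ 0 i χ := by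
  let L : Space N →L[ℝ] Space N := c • ContinuousLinearMap.id ℝ (Space N)
  have hL : ‖L‖ ≤ 1 := by
    refine ContinuousLinearMap.opNorm_le_bound _ zero_le_one fun y => ?_
    change ‖c • y‖ ≤ _
    rw [norm_smul, Real.norm_eq_abs]
    exact mul_le_mul_of_nonneg_right hc1 (norm_nonneg _)
  have h : (dil c hc χ : Space N → ℝ) = χ ∘ L := rfl
  rw [h, ContinuousLinearMap.iteratedFDeriv_comp_right L (χ.smooth ⊤) x
    (by exact_mod_cast le_top)]
  refine (ContinuousMultilinearMap.norm_compContinuousLinearMap_le _ _).trans ?_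
  refine (mul_le_of_le_one_right (norm_nonneg _)
    (Finset.prod_le_one (fun _ _ => norm_nonneg _) fun _ _ => hL)).trans ?_
  exact SchwartzMap.norm_iteratedFDeriv_le_seminorm ℝ χ i _

/-- A smooth compactly supported function equal to `1` on the unit ball. -/
def bump (N : ℕ) : 𝓢(Space N, ℝ) :=
  let b : ContDiffBump (0 : Space N) := ⟨1, 2, one_pos, one_lt_two⟩
  b.hasCompactSupport.toSchwartzMap b.contDiff

theorem hasCompactSupport_bump : HasCompactSupport (bump N) :=
  ContDiffBump.hasCompactSupport (⟨1, 2, one_pos, one_lt_two⟩ : ContDiffBump (0 : Space N))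

theorem bump_eq_one {x : Space N} (hx : ‖x‖ ≤ 1) : bump N x = 1 :=
  ContDiffBump.one_of_mem_closedBall (⟨1, 2, one_pos, one_lt_two⟩ : ContDiffBump (0 : Space N))
    (by simpa using hx)

/-- The cut-off of a Schwartz function at scale `n + 1`. -/
def cutoff (n : ℕ) (ψ : 𝓢(Space N, ℝ)) : 𝓢(Space N, ℝ) :=
  SchwartzMap.smulLeftCLM ℝ (dil ((n : ℝ) + 1)⁻¹ (by positivity) (bump N)) ψ

theorem cutoff_apply (n : ℕ) (ψ : 𝓢(Space N, ℝ)) (x : Space N) :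
    cutoff n ψ x = dil ((n : ℝ) + 1)⁻¹ (by positivity) (bump N) x * ψ x :=
  SchwartzMap.smulLeftCLM_apply_apply (SchwartzMap.hasTemperateGrowth _) _ _

theorem hasCompactSupport_cutoff (n : ℕ) (ψ : 𝓢(Space N, ℝ)) : HasCompactSupport (cutoff n ψ) := by
  have h : (cutoff n ψ : Space N → ℝ) =
      fun x => dil ((n : ℝ) + 1)⁻¹ (by positivity) (bump N) x * ψ x := by
    funext x; exact cutoff_apply n ψ x
  rw [h]
  exact (hasCompactSupport_dil hasCompactSupport_bump _ _).mul_right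

/-- The difference vanishes for `‖x‖ < n + 1`. Elsewhere `‖x‖ ^ k ≤ ‖x‖ ^ (k + 1) / (n + 1)`, so one
extra power of decay of `ψ` pays for the rate; the Leibniz rule supplies the constant. -/
theorem seminorm_cutoff_sub_le (k m : ℕ) (ψ : 𝓢(Space N, ℝ)) :
    ∃ C : ℝ, 0 ≤ C ∧ ∀ n : ℕ, SchwartzMap.seminorm ℝ k m (cutoff n ψ - ψ) ≤ C / ((n : ℝ) + 1) := by
  set C : ℝ := (∑ i ∈ Finset.range (m + 1), (m.choose i : ℝ) * SchwartzMap.seminorm ℝ 0 i (bump N) *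
    SchwartzMap.seminorm ℝ (k + 1) (m - i) ψ) + SchwartzMap.seminorm ℝ (k + 1) m ψ with hC
  have hC0 : 0 ≤ C := by positivity
  refine ⟨C, hC0, fun n => SchwartzMap.seminorm_le_bound ℝ k m _ (by positivity) fun x => ?_⟩
  have hn : (0 : ℝ) < (n : ℝ) + 1 := by positivity
  have hne : ((n : ℝ) + 1)⁻¹ ≠ 0 := by positivity
  rcases lt_or_ge ‖x‖ ((n : ℝ) + 1) with hx | hx
  · have h0 : (cutoff n ψ - ψ : 𝓢(Space N, ℝ)) =ᶠ[𝓝 x] fun _ => (0 : ℝ) := by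
      have : {y : Space N | ‖y‖ < (n : ℝ) + 1} ∈ 𝓝 x :=
        (isOpen_lt continuous_norm continuous_const).mem_nhds hx
      filter_upwards [this] with y hy
      have h1 : ‖((n : ℝ) + 1)⁻¹ • y‖ ≤ 1 := by
        rw [norm_smul, norm_inv, Real.norm_of_nonneg hn.le, inv_mul_le_iff₀ hn, mul_one]
        exact hy.le
      simp only [sub_apply]
      rw [cutoff_apply, dil_apply, bump_eq_one h1]
      ring
    rw [(h0.iteratedFDeriv ℝ m).self_of_nhds]
    have : ‖iteratedFDeriv ℝ m (fun _ : Space N => (0 : ℝ)) x‖ = 0 := by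
      rw [iteratedFDeriv_fun_zero]; simp
    rw [this, mul_zero]
    positivity
  · have hfun : ((cutoff n ψ - ψ : 𝓢(Space N, ℝ)) : Space N → ℝ) =
        (fun y => dil ((n : ℝ) + 1)⁻¹ hne (bump N) y * ψ y) - ψ := by
      funext y
      simp only [sub_apply, Pi.sub_apply, cutoff_apply]
    have hs1 : ContDiff ℝ m (fun y => dil ((n : ℝ) + 1)⁻¹ hne (bump N) y * ψ y) :=
      (SchwartzMap.smooth _ m).mul (ψ.smooth m)
    have habs : |((n : ℝ) + 1)⁻¹| ≤ 1 := by
      rw [abs_of_pos (by positivity)]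
      exact inv_le_one_of_one_le₀ (by linarith [(Nat.cast_nonneg n : (0 : ℝ) ≤ n)])
    have hx1 : ‖x‖ ^ k ≤ ‖x‖ ^ (k + 1) / ((n : ℝ) + 1) := by
      rw [le_div_iff₀ hn, pow_succ]
      exact mul_le_mul_of_nonneg_left hx (by positivity)
    have hbound : ‖iteratedFDeriv ℝ m (cutoff n ψ - ψ : 𝓢(Space N, ℝ)) x‖ ≤
        (∑ i ∈ Finset.range (m + 1), (m.choose i : ℝ) * SchwartzMap.seminorm ℝ 0 i (bump N) *
          ‖iteratedFDeriv ℝ (m - i) ψ x‖) + ‖iteratedFDeriv ℝ m ψ x‖ := by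
      rw [hfun, iteratedFDeriv_sub_apply hs1.contDiffAt (ψ.smooth m).contDiffAt]
      refine (norm_sub_le _ _).trans (add_le_add_left ?_ _)
      refine (norm_iteratedFDeriv_mul_le (SchwartzMap.smooth _ m) (ψ.smooth m) x le_rfl).trans ?_
      refine Finset.sum_le_sum fun i _ => ?_
      gcongr
      exact norm_iteratedFDeriv_dil_le _ _ _ habs _ _
    calc ‖x‖ ^ k * ‖iteratedFDeriv ℝ m (cutoff n ψ - ψ : 𝓢(Space N, ℝ)) x‖
        ≤ ‖x‖ ^ (k + 1) / ((n : ℝ) + 1) *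
          ((∑ i ∈ Finset.range (m + 1), (m.choose i : ℝ) * SchwartzMap.seminorm ℝ 0 i (bump N) *
          ‖iteratedFDeriv ℝ (m - i) ψ x‖) + ‖iteratedFDeriv ℝ m ψ x‖) := by gcongr
      _ = ((∑ i ∈ Finset.range (m + 1), (m.choose i : ℝ) * SchwartzMap.seminorm ℝ 0 i (bump N) *
          (‖x‖ ^ (k + 1) * ‖iteratedFDeriv ℝ (m - i) ψ x‖)) +
          ‖x‖ ^ (k + 1) * ‖iteratedFDeriv ℝ m ψ x‖) / ((n : ℝ) + 1) := by
        rw [div_mul_eq_mul_div, mul_add, Finset.mul_sum]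
        congr 2
        exact Finset.sum_congr rfl fun i _ => by ring
      _ ≤ C / ((n : ℝ) + 1) := by
        rw [hC]
        gcongr
        · exact SchwartzMap.le_seminorm ℝ _ _ ψ x
        · exact SchwartzMap.le_seminorm ℝ _ _ ψ x

theorem tendsto_cutoff (ψ : 𝓢(Space N, ℝ)) : Tendsto (fun n => cutoff n ψ) atTop (𝓝 ψ) := by
  rw [(schwartz_withSeminorms ℝ (Space N) ℝ).tendsto_nhds]
  rintro ⟨k, m⟩ ε hε
  obtain ⟨C, -, h⟩ := seminorm_cutoff_sub_le k m ψ
  have hlim : Tendsto (fun n : ℕ => C / ((n : ℝ) + 1)) atTop (𝓝 0) :=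
    tendsto_const_div_atTop_nhds_zero_nat C |>.comp (tendsto_add_atTop_nat 1) |>.congr
      fun n => by simp
  filter_upwards [hlim.eventually (gt_mem_nhds hε)] with n hn
  exact (h n).trans_lt hn

/-! ### Differentiability of translations -/

/-- Second-order Taylor estimate, from the mean value inequality on the segment from `x` to `x - h`,
applied first to `fderiv ℝ θ` and then to `θ` minus its linear part at `x`. -/
theorem seminorm_translate_zero_le {F : Type} [NormedAddCommGroup F] [NormedSpace ℝ F] (k : ℕ)
    (θ : 𝓢(Space N, F)) : ∃ C : ℝ, ∀ h : Space N, ‖h‖ ≤ 1 →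
      SchwartzMap.seminorm ℝ k 0 (SchwartzMap.compSubConstCLM ℝ h θ - θ + ∂_{h} θ) ≤
        C * ‖h‖ ^ 2 := by
  set θ₂ := SchwartzMap.fderivCLM ℝ (Space N) _ (SchwartzMap.fderivCLM ℝ (Space N) F θ) with hθ₂
  set C := 2 ^ k * ((Finset.Iic (k, 0)).sup
    fun m : ℕ × ℕ => SchwartzMap.seminorm ℝ m.1 m.2) θ₂ with hC
  have hC0 : 0 ≤ C := by positivity
  refine ⟨C, fun h hh => SchwartzMap.seminorm_le_bound ℝ k 0 _ (by positivity) fun x => ?_⟩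
  rw [norm_iteratedFDeriv_zero]
  -- The weight stays at `x` while the derivative is taken at `z`: since `‖h‖ ≤ 1`, `‖x‖ ≤ 1 + ‖z‖`,
  -- which is why the constant uses the seminorms with weight `(1 + ‖z‖) ^ k`.
  have hb : ∀ z ∈ segment ℝ x (x - h), ‖x‖ ^ k * ‖fderiv ℝ (fderiv ℝ θ) z‖ ≤ C := by
    intro z hz
    have hzx : ‖x‖ ≤ 1 + ‖z‖ := by
      have h1 : ‖z - x‖ ≤ 1 := by
        rw [segment_eq_image'] at hz
        obtain ⟨τ, ⟨hτ0, hτ1⟩, rfl⟩ := hz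
        simp only [sub_sub_cancel_left, add_sub_cancel_left, norm_smul, norm_neg, Real.norm_eq_abs,
          abs_of_nonneg hτ0]
        nlinarith [norm_nonneg h]
      have := norm_sub_norm_le x z
      rw [norm_sub_rev] at this
      linarith
    have h2 := SchwartzMap.one_add_le_sup_seminorm_apply (𝕜 := ℝ) (m := (k, 0)) (k := k) (n := 0)
      le_rfl le_rfl θ₂ z
    rw [norm_iteratedFDeriv_zero] at h2
    refine le_trans ?_ h2
    have h3 : (θ₂ z) = fderiv ℝ (fderiv ℝ θ) z := rfl
    rw [h3]
    gcongr
  have hd1 : ∀ z, HasFDerivAt (fderiv ℝ θ) (fderiv ℝ (fderiv ℝ θ) z) z := fun z =>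
    (((θ.smooth 2).fderiv_right (m := 1) (by norm_num)).differentiable (by norm_num) z).hasFDerivAt
  have hd0 : ∀ z, HasFDerivAt θ (fderiv ℝ θ z) z := fun z => θ.hasFDerivAt z
  have hval : (SchwartzMap.compSubConstCLM ℝ h θ - θ + ∂_{h} θ) x =
      (θ (x - h) - fderiv ℝ θ x (x - h)) - (θ x - fderiv ℝ θ x x) := by
    simp only [add_apply, sub_apply,
      SchwartzMap.compSubConstCLM_apply, SchwartzMap.lineDerivOp_apply_eq_fderiv, map_sub]
    abel
  rw [hval]
  rcases eq_or_ne (‖x‖ ^ k) 0 with hx0 | hx0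
  · rw [hx0, zero_mul]; positivity
  have hxpos : 0 < ‖x‖ ^ k := lt_of_le_of_ne (by positivity) hx0.symm
  have hb' : ∀ z ∈ segment ℝ x (x - h), ‖fderiv ℝ (fderiv ℝ θ) z‖ ≤ C / ‖x‖ ^ k := fun z hz => by
    rw [le_div_iff₀ hxpos, mul_comm]; exact hb z hz
  have step1 : ∀ z ∈ segment ℝ x (x - h), ‖fderiv ℝ θ z - fderiv ℝ θ x‖ ≤ C / ‖x‖ ^ k * ‖h‖ := by
    intro z hz
    have h1 := (convex_segment x (x - h)).norm_image_sub_le_of_norm_hasFDerivWithin_le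
      (fun y _ => (hd1 y).hasFDerivWithinAt) hb' (left_mem_segment ℝ _ _) hz
    refine h1.trans ?_
    have hzx : ‖z - x‖ ≤ ‖h‖ := by
      rw [segment_eq_image'] at hz
      obtain ⟨τ, ⟨hτ0, hτ1⟩, rfl⟩ := hz
      simp only [sub_sub_cancel_left, add_sub_cancel_left, norm_smul, norm_neg, Real.norm_eq_abs,
        abs_of_nonneg hτ0]
      nlinarith [norm_nonneg h]
    have : 0 ≤ C / ‖x‖ ^ k := by positivity
    gcongr
  have step2 := (convex_segment x (x - h)).norm_image_sub_le_of_norm_hasFDerivWithin_le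
    (f := fun z => θ z - fderiv ℝ θ x z) (f' := fun z => fderiv ℝ θ z - fderiv ℝ θ x)
    (fun y _ => ((hd0 y).sub (fderiv ℝ θ x).hasFDerivAt).hasFDerivWithinAt) step1
    (left_mem_segment ℝ _ _) (right_mem_segment ℝ _ _)
  have hnorm : ‖x - h - x‖ = ‖h‖ := by rw [sub_sub_cancel_left, norm_neg]
  rw [hnorm] at step2
  calc _ ≤ ‖x‖ ^ k * (C / ‖x‖ ^ k * ‖h‖ * ‖h‖) := by gcongr
    _ = C * ‖h‖ ^ 2 := by field_simp

theorem seminorm_succ_le_fderiv {F : Type} [NormedAddCommGroup F] [NormedSpace ℝ F] (k n : ℕ)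
    (θ : 𝓢(Space N, F)) : SchwartzMap.seminorm ℝ k (n + 1) θ ≤
      SchwartzMap.seminorm ℝ k n (SchwartzMap.fderivCLM ℝ (Space N) F θ) := by
  refine SchwartzMap.seminorm_le_bound ℝ k (n + 1) _ (by positivity) fun x => ?_
  rw [← norm_iteratedFDeriv_fderiv]
  exact SchwartzMap.le_seminorm ℝ k n (SchwartzMap.fderivCLM ℝ (Space N) F θ) x

theorem fderivCLM_translate {F : Type} [NormedAddCommGroup F] [NormedSpace ℝ F]
    (θ : 𝓢(Space N, F)) (h : Space N) :
    SchwartzMap.fderivCLM ℝ (Space N) F (SchwartzMap.compSubConstCLM ℝ h θ - θ + ∂_{h} θ) =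
      SchwartzMap.compSubConstCLM ℝ h (SchwartzMap.fderivCLM ℝ (Space N) F θ) -
        SchwartzMap.fderivCLM ℝ (Space N) F θ + ∂_{h} (SchwartzMap.fderivCLM ℝ (Space N) F θ) := by
  rw [map_add, map_sub]
  congr 1
  · congr 1
    ext1 x
    rw [SchwartzMap.fderivCLM_apply, SchwartzMap.compSubConstCLM_apply, SchwartzMap.fderivCLM_apply]
    have : (SchwartzMap.compSubConstCLM ℝ h θ : Space N → F) = fun y => θ (y - h) := rfl
    rw [this, fderiv_comp_sub]
  · ext1 x
    rw [SchwartzMap.fderivCLM_apply, SchwartzMap.lineDerivOp_apply_eq_fderiv]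
    have e1 : ((∂_{h} θ : 𝓢(Space N, F)) : Space N → F) = fun y => fderiv ℝ θ y h := by
      funext y; exact SchwartzMap.lineDerivOp_apply_eq_fderiv _ _ _
    have e2 : (SchwartzMap.fderivCLM ℝ (Space N) F θ : Space N → Space N →L[ℝ] F) = fderiv ℝ θ :=
      rfl
    have hd : DifferentiableAt ℝ (fderiv ℝ θ) x :=
      ((θ.smooth 2).fderiv_right (m := 1) (by norm_num)).differentiable (by norm_num) x
    rw [e1, e2]
    ext m
    rw [fderiv_clm_apply hd (differentiableAt_const _)]
    simpa using ((θ.smooth 2).contDiffAt.isSymmSndFDerivAt (by simp)) m h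

/-- The Taylor remainder commutes with differentiation, so the order `n` can be lowered by passing
from `θ` to its derivative. The target `F` is quantified inside the induction because this step
replaces it by `Space N →L[ℝ] F`. -/
theorem seminorm_translate_le (k n : ℕ) : ∀ {F : Type} [NormedAddCommGroup F] [NormedSpace ℝ F]
    (θ : 𝓢(Space N, F)), ∃ C : ℝ, ∀ h : Space N, ‖h‖ ≤ 1 →
      SchwartzMap.seminorm ℝ k n (SchwartzMap.compSubConstCLM ℝ h θ - θ + ∂_{h} θ) ≤
        C * ‖h‖ ^ 2 := by
  induction n with
  | zero => intro F _ _ θ; exact seminorm_translate_zero_le k θ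
  | succ n ih =>
    intro F _ _ θ
    obtain ⟨C, hC⟩ := ih (SchwartzMap.fderivCLM ℝ (Space N) F θ)
    refine ⟨C, fun h hh => (seminorm_succ_le_fderiv k n _).trans ?_⟩
    rw [fderivCLM_translate]
    exact hC h hh

/-! ### Correlation of a tempered distribution with a Schwartz function. -/

theorem exists_bound_tempered (g : Tempered N) : ∃ (s : Finset (ℕ × ℕ)) (C : ℝ), 0 ≤ C ∧
    ∀ ψ, |g ψ| ≤ C * ∑ m ∈ s, SchwartzMap.seminorm ℝ m.1 m.2 ψ := by
  obtain ⟨s, C, -, h⟩ := Seminorm.bound_of_continuous (schwartz_withSeminorms ℝ (Space N) ℝ)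
    ((normSeminorm ℝ ℝ).comp g.toLinearMap) (continuous_norm.comp g.continuous)
  refine ⟨s, C, C.2, fun ψ => (h ψ).trans ?_⟩
  change (C : ℝ) * _ ≤ _
  refine mul_le_mul_of_nonneg_left ?_ C.2
  refine Seminorm.finset_sup_apply_le (by positivity) fun m hm => ?_
  exact Finset.single_le_sum (f := fun m : ℕ × ℕ => SchwartzMap.seminorm ℝ m.1 m.2 ψ)
    (fun _ _ => by positivity) hm

/-- The function `x ↦ ⟨g, ψ(· - x)⟩`. -/
def corr (g : Tempered N) (ψ : 𝓢(Space N, ℝ)) (x : Space N) : ℝ :=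
  g (SchwartzMap.compSubConstCLM ℝ x ψ)

/-- The linear functional `h ↦ ∑ i, a i * h i`. -/
def dotL (a : Fin N → ℝ) : Space N →L[ℝ] ℝ :=
  ∑ i, a i • (EuclideanSpace.proj i : Space N →L[ℝ] ℝ)

@[simp]
theorem dotL_apply (a : Fin N → ℝ) (h : Space N) : dotL a h = ∑ i, a i * h i := by
  simp [dotL]

theorem lineDeriv_eq_sum (h : Space N) (ψ : 𝓢(Space N, ℝ)) : ∂_{h} ψ = ∑ i, h i • pd i ψ := by
  ext x
  have hh : h = ∑ i, h i • EuclideanSpace.single i (1 : ℝ) := by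
    ext j; simp [Pi.single_apply]
  rw [SchwartzMap.lineDerivOp_apply_eq_fderiv]
  conv_lhs => rw [hh]
  simp [map_sum, pd_apply]

/-- A tempered distribution is bounded by finitely many seminorms, and in each of them the Taylor
remainder of a translation is `O(‖h‖²)`. The sign comes from translating by `-x`. -/
theorem hasFDerivAt_corr (g : Tempered N) (ψ : 𝓢(Space N, ℝ)) (x : Space N) :
    HasFDerivAt (corr g ψ) (dotL fun i => -corr g (pd i ψ) x) x := by
  set g' : Tempered N := g.comp (SchwartzMap.compSubConstCLM ℝ x) with hg'
  obtain ⟨s, C, hC, hbd⟩ := exists_bound_tempered g'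
  choose D hD using fun m : ℕ × ℕ => seminorm_translate_le (N := N) m.1 m.2 ψ
  rw [hasFDerivAt_iff_isLittleO_nhds_zero]
  have hbig : (fun h => corr g ψ (x + h) - corr g ψ x - dotL (fun i => -corr g (pd i ψ) x) h)
      =O[𝓝 0] fun h : Space N => ‖h‖ ^ 2 := by
    refine Asymptotics.IsBigO.of_bound (C * ∑ m ∈ s, D m) ?_
    filter_upwards [Metric.closedBall_mem_nhds (0 : Space N) one_pos] with h hh
    have hh1 : ‖h‖ ≤ 1 := by simpa using hh
    have e : corr g ψ (x + h) - corr g ψ x - dotL (fun i => -corr g (pd i ψ) x) h =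
        g' (SchwartzMap.compSubConstCLM ℝ h ψ - ψ + ∂_{h} ψ) := by
      rw [map_add, map_sub, lineDeriv_eq_sum, map_sum, dotL_apply]
      have e1 : corr g ψ (x + h) = g' (SchwartzMap.compSubConstCLM ℝ h ψ) := by
        simp only [corr, hg', ContinuousLinearMap.comp_apply]
        congr 1
        ext y
        simp [SchwartzMap.compSubConstCLM_apply, add_comm]
      rw [e1]
      simp only [map_smul, smul_eq_mul, neg_mul, Finset.sum_neg_distrib, sub_neg_eq_add]
      congr 1
      exact Finset.sum_congr rfl fun i _ => mul_comm _ _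
    rw [e, Real.norm_eq_abs, norm_pow, norm_norm]
    refine (hbd _).trans ?_
    rw [mul_assoc, Finset.sum_mul]
    exact mul_le_mul_of_nonneg_left (Finset.sum_le_sum fun m _ => hD m h hh1) hC
  refine hbig.trans_isLittleO ?_
  exact Asymptotics.isLittleO_norm_pow_id one_lt_two

theorem continuous_corr (g : Tempered N) (ψ : 𝓢(Space N, ℝ)) : Continuous (corr g ψ) :=
  continuous_iff_continuousAt.2 fun x => (hasFDerivAt_corr g ψ x).continuousAt

/-! ### The equation for the pressure at almost every time -/

theorem ae_memLp_of_memL1Lq {F : Type*} [NormedAddCommGroup F] {T : ℝ} {q : ℝ≥0∞}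
    (hq0 : q ≠ 0) (hqt : q ≠ ∞) {f : ℝ → Space N → F} (hf : MemL1Lq T q f) :
    ∀ᵐ t ∂(timeMeasure T), MemLp (f t) q volume := by
  have : SFinite (timeMeasure T) := by unfold timeMeasure; infer_instance
  obtain ⟨hmeas, hint⟩ := hf
  have h1 : ∀ᵐ t ∂(timeMeasure T), AEStronglyMeasurable (f t) volume := hmeas.prodMk_left
  have h2 : AEMeasurable (fun t => eLpNorm (f t) q volume) (timeMeasure T) := by
    have : (fun t => eLpNorm (f t) q volume) =
        fun t => (∫⁻ x, ‖f t x‖ₑ ^ q.toReal) ^ (1 / q.toReal) := by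
      funext t; exact eLpNorm_eq_lintegral_rpow_enorm_toReal hq0 hqt
    rw [this]
    have h3 : AEMeasurable (fun z : ℝ × Space N => ‖f z.1 z.2‖ₑ ^ q.toReal)
        ((timeMeasure T).prod volume) := hmeas.enorm.pow_const _
    exact h3.lintegral_prod_right'.pow_const _
  filter_upwards [h1, ae_lt_top' h2 hint.ne] with t ht1 ht2
  exact ⟨ht1, ht2⟩

theorem integrable_mul_components {u : Space N → Space N} (hu : MemLp u 2 volume) (i j : Fin N) :
    Integrable fun x => u x i * u x j := by
  have h : ∀ k : Fin N, MemLp (fun x => u x k) 2 volume := fun k =>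
    hu.continuousLinearMap_comp (EuclideanSpace.proj k : Space N →L[ℝ] ℝ)
  exact (h i).integrable_mul (h j)

/-- The quadratic term is only integrable in time after multiplication by a test function, so `G` is
merely locally integrable on `(0,T)`; a bump equal to `1` near a given time shows this, and the
fundamental lemma of the calculus of variations applies. -/
theorem ae_eq_zero_of_integral_mul_eq_zero {T : ℝ} {G : ℝ → ℝ}
    (hint : ∀ ξ : ℝ → ℝ, ContDiff ℝ 1 ξ → HasCompactSupport ξ → tsupport ξ ⊆ Ioo 0 T →
      Integrable (fun t => G t * ξ t) (timeMeasure T))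
    (hzero : ∀ ξ : ℝ → ℝ, ContDiff ℝ 1 ξ → HasCompactSupport ξ → tsupport ξ ⊆ Ioo 0 T →
      ∫ t, G t * ξ t ∂(timeMeasure T) = 0) :
    ∀ᵐ t ∂(timeMeasure T), G t = 0 := by
  have hloc : LocallyIntegrableOn G (Ioo 0 T) volume := by
    intro t₀ ht₀
    obtain ⟨r, hr, hball⟩ := Metric.isOpen_iff.1 isOpen_Ioo t₀ ht₀
    let b : ContDiffBump t₀ := ⟨r / 4, r / 2, by positivity, by linarith⟩
    have hb := hint b b.contDiff b.hasCompactSupport (by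
      rw [b.tsupport_eq]
      exact (Metric.closedBall_subset_ball (by change r / 2 < r; linarith)).trans hball)
    refine ⟨Metric.ball t₀ (r / 4), mem_nhdsWithin_of_mem_nhds
      (Metric.ball_mem_nhds _ (by positivity)), ?_⟩
    have hsub : Metric.ball t₀ (r / 4) ⊆ Ioo 0 T :=
      (Metric.ball_subset_ball (by linarith)).trans hball
    have h1 : IntegrableOn (fun t => G t * b t) (Metric.ball t₀ (r / 4)) volume :=
      IntegrableOn.mono_set hb hsub
    refine h1.congr_fun (fun t ht => ?_) Metric.isOpen_ball.measurableSet
    change G t * b t = G t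
    rw [b.one_of_mem_closedBall (Metric.ball_subset_closedBall ht), mul_one]
  have := isOpen_Ioo.ae_eq_zero_of_integral_contDiff_smul_eq_zero hloc fun g hg hgc hgs => by
    have h := hzero g (hg.of_le (by exact_mod_cast le_top)) hgc hgs
    rw [timeMeasure, setIntegral_eq_integral_of_forall_compl_eq_zero] at h
    · simpa only [smul_eq_mul, mul_comm] using h
    · intro t ht
      rw [image_eq_zero_of_notMem_tsupport (fun h => ht (hgs h)), mul_zero]
  rw [timeMeasure, ae_restrict_iff' measurableSet_Ioo]
  exact this

/-- The test field is `∇ψ`: incompressibility tested against `ψ` and against `lap ψ` cancels the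
time derivative and the viscosity. -/
theorem ae_pressure_identity_of_hasCompactSupport {ν T : ℝ} {v : ℝ → Space N → Space N}
    {p : ℝ → Tempered N} (hsol : IsWeakSolution ν T v p) (ψ : 𝓢(Space N, ℝ))
    (hψ : HasCompactSupport ψ) :
    ∀ᵐ t ∂(timeMeasure T),
      (∫ x, ∑ i, ∑ j, v t x i * v t x j * pd i (pd j ψ) x) + p t (lap ψ) = 0 := by
  have hc : ∀ j, HasCompactSupport (pd j ψ) := hasCompactSupport_pd hψ
  have hp : ∀ ξ : ℝ → ℝ, ContDiff ℝ 1 ξ → HasCompactSupport ξ →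
      Integrable (fun t => p t (lap ψ) * ξ t) (timeMeasure T) := by
    intro ξ hξ hξc
    obtain ⟨C, hC⟩ := hξc.exists_bound_of_continuous hξ.continuous
    exact (hsol.pressure (lap ψ)).mul_bdd (c := C) hξ.continuous.aestronglyMeasurable (ae_of_all _ hC)
  refine ae_eq_zero_of_integral_mul_eq_zero (fun ξ h1 h2 h3 => ?_) (fun ξ h1 h2 h3 => ?_)
  · simp only [add_mul]
    exact (hsol.integrable_quadratic (fun j => pd j ψ) ξ hc h1 h2 h3).add (hp ξ h1 h2)
  · simp only [add_mul]
    rw [integral_add (hsol.integrable_quadratic (fun j => pd j ψ) ξ hc h1 h2 h3) (hp ξ h1 h2)]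
    have hw := hsol.weak_formulation (fun j => pd j ψ) ξ hc h1 h2 h3
    have z1 : ∫ t, (∫ x, ∑ j, v t x j * pd j ψ x) * deriv ξ t ∂(timeMeasure T) = 0 := by
      refine integral_eq_zero_of_ae ?_
      filter_upwards [hsol.divFree] with t ht
      rw [ht ψ hψ, zero_mul]; rfl
    have z2 : ∫ t, (∫ x, ∑ j, v t x j * lap (pd j ψ) x) * ξ t ∂(timeMeasure T) = 0 := by
      refine integral_eq_zero_of_ae ?_
      filter_upwards [hsol.divFree] with t ht
      simp only [lap_pd]
      rw [ht (lap ψ) (hasCompactSupport_lap hψ), zero_mul]; rfl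
    have z3 : divergence (fun j => pd j ψ) = lap ψ := rfl
    rw [z1, z2, z3] at hw
    linarith

/-! ### The pressure identity for all Schwartz test functions. -/

theorem integrable_mul_schwartz {w : Space N → ℝ} (hw : Integrable w) (ψ : 𝓢(Space N, ℝ)) :
    Integrable fun x => w x * ψ x :=
  hw.mul_bdd (c := SchwartzMap.seminorm ℝ 0 0 ψ) ψ.continuous.aestronglyMeasurable
    (ae_of_all _ (SchwartzMap.norm_le_seminorm ℝ ψ))

theorem continuous_integral_mul_schwartz {w : Space N → ℝ} (hw : Integrable w) :
    Continuous fun ψ : 𝓢(Space N, ℝ) => ∫ x, w x * ψ x := by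
  let L : 𝓢(Space N, ℝ) →L[ℝ] ℝ := SchwartzMap.mkCLMtoNormedSpace (σ := RingHom.id ℝ)
    (fun ψ => ∫ x, w x * ψ x)
    (fun f g => by
      simp only [add_apply, mul_add]
      exact integral_add (integrable_mul_schwartz hw f) (integrable_mul_schwartz hw g))
    (fun a f => by
      simp only [smul_apply, smul_eq_mul, RingHom.id_apply, ← integral_const_mul]
      exact integral_congr_ae (ae_of_all _ fun x => by ring))
    ⟨{(0, 0)}, ∫ x, ‖w x‖, by positivity, fun f => by
      rw [← integral_mul_const]
      refine norm_integral_le_of_norm_le (hw.norm.mul_const _) (ae_of_all _ fun x => ?_)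
      rw [norm_mul]
      gcongr
      simpa using SchwartzMap.norm_le_seminorm ℝ f x⟩
  exact L.continuous

/-- The pairing `∑ i j, ∫ w_ij ∂_i ∂_j ψ` of a matrix of integrable functions with a Hessian. -/
def hessPairing (w : Fin N → Fin N → Space N → ℝ) (ψ : 𝓢(Space N, ℝ)) : ℝ :=
  ∑ i, ∑ j, ∫ x, w i j x * pd i (pd j ψ) x

theorem continuous_hessPairing {w : Fin N → Fin N → Space N → ℝ} (hw : ∀ i j, Integrable (w i j)) :
    Continuous (hessPairing w) :=
  continuous_finsetSum _ fun i _ => continuous_finsetSum _ fun j _ =>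
    (continuous_integral_mul_schwartz (hw i j)).comp ((continuous_pd i).comp (continuous_pd j))

theorem integral_sum_eq_hessPairing {w : Fin N → Fin N → Space N → ℝ}
    (hw : ∀ i j, Integrable (w i j)) (ψ : 𝓢(Space N, ℝ)) :
    ∫ x, ∑ i, ∑ j, w i j x * pd i (pd j ψ) x = hessPairing w ψ := by
  rw [integral_finsetSum _ fun i _ => integrable_finsetSum _ fun j _ =>
    integrable_mul_schwartz (hw i j) _]
  exact Finset.sum_congr rfl fun i _ => integral_finsetSum _ fun j _ =>
    integrable_mul_schwartz (hw i j) _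

/-- Both sides are continuous in `ψ` for the Schwartz topology, and the countably many cut-offs of
`ψ` share one null set of times. -/
theorem ae_hessPairing_eq {ν T : ℝ} {v : ℝ → Space N → Space N}
    {p : ℝ → Tempered N} (hsol : IsWeakSolution ν T v p) (ψ : 𝓢(Space N, ℝ)) :
    ∀ᵐ t ∂(timeMeasure T),
      hessPairing (fun i j x => v t x i * v t x j) ψ = - p t (lap ψ) := by
  have h := ae_all_iff.2 fun n => ae_pressure_identity_of_hasCompactSupport hsol (cutoff n ψ)
    (hasCompactSupport_cutoff n ψ)
  filter_upwards [h, ae_memLp_of_memL1Lq two_ne_zero (by simp) hsol.memL1L2] with t ht hv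
  have hw := integrable_mul_components hv
  have h1 : Tendsto (fun n => hessPairing (fun i j x => v t x i * v t x j) (cutoff n ψ)) atTop
      (𝓝 (hessPairing (fun i j x => v t x i * v t x j) ψ)) :=
    ((continuous_hessPairing hw).tendsto ψ).comp (tendsto_cutoff ψ)
  have h2 : Tendsto (fun n => - p t (lap (cutoff n ψ))) atTop (𝓝 (- p t (lap ψ))) :=
    (((p t).continuous.comp continuous_lap).neg.tendsto ψ).comp (tendsto_cutoff ψ)
  refine tendsto_nhds_unique h1 (h2.congr fun n => ?_)
  have := ht n
  rw [integral_sum_eq_hessPairing hw] at this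
  linarith

/-! ### Large dilations -/

/-- Dominated convergence: seen from far away, an integrable function is a point mass. The shift `x`
is zero for integrable pressure and arbitrary in the Hardy case. -/
theorem tendsto_integral_mul_dil {w : Space N → ℝ} (hw : Integrable w) (ψ : 𝓢(Space N, ℝ))
    (x : Space N) :
    Tendsto (fun n : ℕ => ∫ y, w y * ψ (((n : ℝ) + 1)⁻¹ • y - x)) atTop
      (𝓝 ((∫ y, w y) * ψ (-x))) := by
  rw [← integral_mul_const]
  refine tendsto_integral_of_dominated_convergence
    (fun y => ‖w y‖ * SchwartzMap.seminorm ℝ 0 0 ψ) (fun n => ?_) (hw.norm.mul_const _)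
    (fun n => ae_of_all _ fun y => ?_) (ae_of_all _ fun y => ?_)
  · exact hw.aestronglyMeasurable.mul (by fun_prop : Continuous fun y : Space N =>
      ψ (((n : ℝ) + 1)⁻¹ • y - x)).aestronglyMeasurable
  · rw [norm_mul]
    gcongr
    exact SchwartzMap.norm_le_seminorm ℝ ψ _
  · have h0 : Tendsto (fun n : ℕ => ((n : ℝ) + 1)⁻¹) atTop (𝓝 0) := by
      simpa [one_div] using tendsto_one_div_add_atTop_nhds_zero_nat (𝕜 := ℝ)
    have h1 : Tendsto (fun n : ℕ => ((n : ℝ) + 1)⁻¹ • y - x) atTop (𝓝 (-x)) := by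
      simpa using (h0.smul_const y).sub_const x
    exact ((ψ.continuous.tendsto _).comp h1).const_mul _

/-- The coordinate function `x ↦ x k * x l`, cut off near infinity. -/
def quadTest (k l : Fin N) : 𝓢(Space N, ℝ) :=
  (show HasCompactSupport (fun x : Space N => bump N x * (x k * x l)) from
    hasCompactSupport_bump.mul_right).toSchwartzMap
    (((bump N).smooth ⊤).mul (by fun_prop))

theorem hasFDerivAt_coord_mul (k l : Fin N) (x : Space N) :
    HasFDerivAt (fun x : Space N => x k * x l)
      (x k • (EuclideanSpace.proj l : Space N →L[ℝ] ℝ) + x l • EuclideanSpace.proj k) x :=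
  ((EuclideanSpace.proj k : Space N →L[ℝ] ℝ).hasFDerivAt (x := x)).mul
    ((EuclideanSpace.proj l : Space N →L[ℝ] ℝ).hasFDerivAt (x := x))

theorem pd_pd_quadTest_zero (i j k l : Fin N) : pd i (pd j (quadTest k l)) 0 =
    (if i = k then 1 else 0) * (if j = l then 1 else 0) +
      (if i = l then 1 else 0) * (if j = k then 1 else 0) := by
  have h1 : ∀ x : Space N, ‖x‖ < 1 → pd j (quadTest k l) x =
      x k * (if j = l then 1 else 0) + x l * (if j = k then 1 else 0) := by
    intro x hx
    have he : quadTest k l =ᶠ[𝓝 x] fun x : Space N => x k * x l := by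
      filter_upwards [(isOpen_lt continuous_norm continuous_const).mem_nhds hx] with y hy
      change bump N y * (y k * y l) = _
      rw [bump_eq_one (le_of_lt hy), one_mul]
    rw [pd_apply, he.fderiv_eq, (hasFDerivAt_coord_mul k l x).fderiv]
    simp [eq_comm]
  have h2 : pd j (quadTest k l) =ᶠ[𝓝 0] fun x : Space N =>
      x k * (if j = l then 1 else 0) + x l * (if j = k then 1 else 0) := by
    filter_upwards [Metric.ball_mem_nhds (0 : Space N) one_pos] with x hx
    exact h1 x (by simpa using hx)
  have h3 : HasFDerivAt (fun x : Space N =>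
      x k * (if j = l then (1 : ℝ) else 0) + x l * (if j = k then 1 else 0))
      ((if j = l then (1 : ℝ) else 0) • (EuclideanSpace.proj k : Space N →L[ℝ] ℝ) +
        (if j = k then (1 : ℝ) else 0) • EuclideanSpace.proj l) 0 :=
    (((EuclideanSpace.proj k : Space N →L[ℝ] ℝ).hasFDerivAt (x := 0)).mul_const _).add
      (((EuclideanSpace.proj l : Space N →L[ℝ] ℝ).hasFDerivAt (x := 0)).mul_const _)
  rw [pd_apply, h2.fderiv_eq, h3.fderiv]
  have hs : ∀ m : Fin N, (EuclideanSpace.proj m : Space N →L[ℝ] ℝ) (EuclideanSpace.single i 1) =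
      if i = m then 1 else 0 := by intro m; simp [eq_comm]
  simp only [add_apply, smul_apply, smul_eq_mul, hs]
  ring

/-! ### Integrable pressure -/

theorem tendsto_hessPairing_dil {w : Fin N → Fin N → Space N → ℝ} (hw : ∀ i j, Integrable (w i j))
    (ψ : 𝓢(Space N, ℝ)) :
    Tendsto (fun n : ℕ => ((n : ℝ) + 1) ^ 2 *
      hessPairing w (dil ((n : ℝ) + 1)⁻¹ (by positivity) ψ)) atTop
      (𝓝 (∑ i, ∑ j, (∫ y, w i j y) * pd i (pd j ψ) 0)) := by
  have h : Tendsto (fun n : ℕ => ∑ i, ∑ j, ∫ y, w i j y * pd i (pd j ψ) (((n : ℝ) + 1)⁻¹ • y - 0))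
      atTop (𝓝 (∑ i, ∑ j, (∫ y, w i j y) * pd i (pd j ψ) (-0))) :=
    tendsto_finsetSum _ fun i _ => tendsto_finsetSum _ fun j _ =>
      tendsto_integral_mul_dil (hw i j) _ _
  rw [neg_zero] at h
  refine h.congr fun n => ?_
  have hn : ((n : ℝ) + 1) ≠ 0 := by positivity
  simp only [hessPairing, Finset.mul_sum, ← integral_const_mul]
  refine Finset.sum_congr rfl fun i _ => Finset.sum_congr rfl fun j _ =>
    integral_congr_ae (ae_of_all _ fun y => ?_)
  simp only [pd_pd_dil, smul_apply, dil_apply, smul_eq_mul, sub_zero]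
  field_simp

theorem stress_eq_of_integrable_pressure {w : Fin N → Fin N → Space N → ℝ}
    (hw : ∀ i j, Integrable (w i j)) {P : Space N → ℝ} (hP : Integrable P) (ψ : 𝓢(Space N, ℝ))
    (h : ∀ n : ℕ, hessPairing w (dil ((n : ℝ) + 1)⁻¹ (by positivity) ψ) =
      -∫ x, P x * lap (dil ((n : ℝ) + 1)⁻¹ (by positivity) ψ) x) :
    ∑ i, ∑ j, (∫ y, w i j y) * pd i (pd j ψ) 0 = -((∫ y, P y) * lap ψ 0) := by
  refine tendsto_nhds_unique (tendsto_hessPairing_dil hw ψ) ?_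
  have h2 := (tendsto_integral_mul_dil hP (lap ψ) 0).neg
  rw [neg_zero] at h2
  refine h2.congr fun n => ?_
  have hn : ((n : ℝ) + 1) ≠ 0 := by positivity
  rw [h n, mul_neg, ← integral_const_mul]
  congr 1
  refine integral_congr_ae (ae_of_all _ fun y => ?_)
  simp only [lap_dil, smul_apply, dil_apply, smul_eq_mul, sub_zero]
  field_simp

theorem ae_stress_eq_pressure {ν T : ℝ} {v : ℝ → Space N → Space N}
    {p : ℝ → Tempered N} (hsol : IsWeakSolution ν T v p) {P : ℝ → Space N → ℝ}
    (hP : IsL1L1Density T p P) :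
    ∀ᵐ t ∂(timeMeasure T), ∀ k l, ∫ x, v t x k * v t x l = if k = l then -∫ x, P t x else 0 := by
  have h := ae_all_iff.2 fun k : Fin N => ae_all_iff.2 fun l : Fin N => ae_all_iff.2 fun n : ℕ =>
    ae_hessPairing_eq hsol (dil ((n : ℝ) + 1)⁻¹ (by positivity) (quadTest k l))
  filter_upwards [h, hP.2, ae_memLp_of_memL1Lq two_ne_zero (by simp) hsol.memL1L2,
    ae_memLp_of_memL1Lq one_ne_zero (by simp) hP.1] with t ht hpt hv hPt k l
  have key := stress_eq_of_integrable_pressure (integrable_mul_components hv)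
    (memLp_one_iff_integrable.1 hPt) (quadTest k l) fun n => by rw [ht k l n, hpt]
  -- Near the origin `quadTest k l` is `x_k x_l`, so its Hessian picks out the `(k,l)` and `(l,k)`
  -- entries; symmetry of the stress makes the other side twice the `(k,l)` entry.
  have hlap : lap (quadTest k l) 0 = 2 * if k = l then 1 else 0 := by
    simp only [lap, sum_apply, pd_pd_quadTest_zero]
    split_ifs with hkl
    · subst hkl
      have : ∀ i : Fin N, (if i = k then (1 : ℝ) else 0) * (if i = k then 1 else 0) +
          (if i = k then 1 else 0) * (if i = k then 1 else 0) = if i = k then 2 else 0 := by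
        intro i
        split_ifs <;> norm_num
      simp only [this, Finset.sum_ite_eq', Finset.mem_univ, if_true, mul_one]
    · have : ∀ i : Fin N, (if i = k then (1 : ℝ) else 0) * (if i = l then 1 else 0) = 0 := by
        intro i
        split_ifs with h1 h2
        · exact absurd (h1.symm.trans h2) hkl
        all_goals simp
      simp [this, mul_comm (if _ = l then (1 : ℝ) else 0)]
  rw [hlap] at key
  simp only [pd_pd_quadTest_zero, mul_add, Finset.sum_add_distrib] at key
  simp only [mul_ite, mul_one, mul_zero, Finset.sum_ite_eq', Finset.mem_univ, if_true] at key
  have hsymm : ∫ x, v t x l * v t x k = ∫ x, v t x k * v t x l := by simp only [mul_comm]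
  rw [hsymm] at key
  split_ifs at key ⊢ <;> linarith

/-! ### A mean value inequality -/

/-- The kernel `(1 - |y|²)₊²`. -/
def zetaKer (y : Space N) : ℝ := max 0 (1 - ‖y‖ ^ 2) ^ 2

/-- The kernel `4 (1 - |y|²)₊`, for which `∇ ζ (y) = - η(y) y`. -/
def etaKer (y : Space N) : ℝ := 4 * max 0 (1 - ‖y‖ ^ 2)

theorem continuous_zetaKer : Continuous (zetaKer : Space N → ℝ) := by
  unfold zetaKer; fun_prop

theorem continuous_etaKer : Continuous (etaKer : Space N → ℝ) := by
  unfold etaKer; fun_prop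

theorem zetaKer_nonneg (y : Space N) : 0 ≤ zetaKer y := by unfold zetaKer; positivity

theorem etaKer_nonneg (y : Space N) : 0 ≤ etaKer y := by unfold etaKer; positivity

theorem etaKer_le (y : Space N) : etaKer y ≤ 4 := by
  have : max 0 (1 - ‖y‖ ^ 2) ≤ 1 := max_le zero_le_one (by nlinarith [sq_nonneg ‖y‖])
  unfold etaKer; linarith

theorem max_eq_zero_of_notMem {y : Space N} (hy : y ∉ Metric.closedBall (0 : Space N) 1) :
    max 0 (1 - ‖y‖ ^ 2) = 0 := by
  have : 1 < ‖y‖ := by simpa using hy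
  exact max_eq_left (by nlinarith)

theorem etaKer_eq_zero {y : Space N} (hy : y ∉ Metric.closedBall (0 : Space N) 1) :
    etaKer y = 0 := by
  rw [etaKer, max_eq_zero_of_notMem hy, mul_zero]

theorem hasCompactSupport_zetaKer : HasCompactSupport (zetaKer : Space N → ℝ) :=
  HasCompactSupport.intro (isCompact_closedBall (0 : Space N) 1) fun y hy => by
    rw [zetaKer, max_eq_zero_of_notMem hy]; norm_num

theorem hasCompactSupport_etaKer : HasCompactSupport (etaKer : Space N → ℝ) :=
  HasCompactSupport.intro (isCompact_closedBall (0 : Space N) 1) fun _ hy => etaKer_eq_zero hy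

theorem integral_etaKer_pos : 0 < ∫ y : Space N, etaKer y :=
  continuous_etaKer.integral_pos_of_hasCompactSupport_nonneg_nonzero hasCompactSupport_etaKer
    etaKer_nonneg (x := 0) (by simp [etaKer])

theorem hasDerivAt_max_sq (s : ℝ) : HasDerivAt (fun s : ℝ => max 0 s ^ 2) (2 * max 0 s) s := by
  rcases lt_trichotomy s 0 with hs | rfl | hs
  · have h : (fun s : ℝ => max 0 s ^ 2) =ᶠ[𝓝 s] fun _ => 0 := by
      filter_upwards [gt_mem_nhds hs] with y hy
      rw [max_eq_left hy.le]; norm_num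
    rw [max_eq_left hs.le, mul_zero]
    exact (hasDerivAt_const s (0 : ℝ)).congr_of_eventuallyEq h
  · rw [max_self, mul_zero, hasDerivAt_iff_isLittleO_nhds_zero]
    refine Asymptotics.IsBigO.trans_isLittleO (g := fun h : ℝ => ‖h‖ ^ 2) ?_
      (Asymptotics.isLittleO_norm_pow_id one_lt_two)
    refine Asymptotics.IsBigO.of_bound 1 (Eventually.of_forall fun h => ?_)
    have h1 : |max 0 h| ≤ |h| := by
      rw [abs_of_nonneg (le_max_left 0 h)]
      exact max_le (abs_nonneg h) (le_abs_self h)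
    simpa using pow_le_pow_left₀ (abs_nonneg _) h1 2
  · have h : (fun s : ℝ => max 0 s ^ 2) =ᶠ[𝓝 s] fun s => s ^ 2 := by
      filter_upwards [lt_mem_nhds hs] with y hy
      rw [max_eq_right hy.le]
    rw [max_eq_right hs.le]
    simpa using (hasDerivAt_pow 2 s).congr_of_eventuallyEq h

theorem hasFDerivAt_zetaKer (y : Space N) :
    HasFDerivAt (zetaKer : Space N → ℝ) (dotL fun i => -(y i * etaKer y)) y := by
  have h1 : HasFDerivAt (fun y : Space N => 1 - ‖y‖ ^ 2) (-(2 • innerSL ℝ y)) y :=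
    (hasStrictFDerivAt_norm_sq y).hasFDerivAt.const_sub 1
  have h2 := (hasDerivAt_max_sq (1 - ‖y‖ ^ 2)).comp_hasFDerivAt y h1
  refine h2.congr_fderiv ?_
  ext h
  have : inner ℝ y h = ∑ i, y i * h i := by
    rw [PiLp.inner_apply]
    exact Finset.sum_congr rfl fun i _ => by simp [mul_comm]
  simp only [dotL_apply, smul_apply, neg_apply, innerSL_apply_apply, this, smul_eq_mul, etaKer,
    nsmul_eq_mul, Finset.mul_sum, ← Finset.sum_neg_distrib]
  exact Finset.sum_congr rfl fun i _ => by push_cast; ring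

theorem dotL_single (a : Fin N → ℝ) (i : Fin N) : dotL a (EuclideanSpace.single i 1) = a i := by
  simp

/-- Integration by parts against a compactly supported function. -/
theorem integral_mul_deriv_eq_neg {f f' g g' : Space N → ℝ} {e : Space N} (hf : Continuous f)
    (hf' : Continuous f') (hg : Continuous g) (hg' : Continuous g') (hgc : HasCompactSupport g)
    (hgc' : HasCompactSupport g') (hff' : ∀ x, HasLineDerivAt ℝ f (f' x) x e)
    (hgg' : ∀ x, HasLineDerivAt ℝ g (g' x) x e) :
    ∫ x, f x * g' x = -∫ x, f' x * g x :=
  integral_bilinear_hasLineDerivAt_right_eq_neg_left_of_integrable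
    (B := ContinuousLinearMap.mul ℝ ℝ)
    ((hf'.mul hg).integrable_of_hasCompactSupport hgc.mul_left)
    ((hf.mul hg').integrable_of_hasCompactSupport hgc'.mul_left)
    ((hf.mul hg).integrable_of_hasCompactSupport hgc.mul_left)
    (fun x _ => hff' x) (fun x _ => hgg' x)

/-- `u` is twice differentiable, with first derivatives `a i` and pure second derivatives `b i`. -/
structure HasPureSecondDerivs (u : Space N → ℝ) (a b : Fin N → Space N → ℝ) : Prop where
  hasFDerivAt : ∀ x, HasFDerivAt u (dotL fun i => a i x) x
  differentiable : ∀ i, Differentiable ℝ (a i)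
  fderiv_single : ∀ i x, fderiv ℝ (a i) x (EuclideanSpace.single i 1) = b i x
  continuous_snd : ∀ i, Continuous (b i)

namespace HasPureSecondDerivs

variable {u : Space N → ℝ} {a b : Fin N → Space N → ℝ}

theorem continuous (h : HasPureSecondDerivs u a b) : Continuous u :=
  continuous_iff_continuousAt.2 fun x => (h.hasFDerivAt x).continuousAt

theorem continuous_fst (h : HasPureSecondDerivs u a b) (i : Fin N) : Continuous (a i) :=
  (h.differentiable i).continuous

theorem hasLineDerivAt (h : HasPureSecondDerivs u a b) (i : Fin N) (x : Space N) :
    HasLineDerivAt ℝ u (a i x) x (EuclideanSpace.single i 1) := by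
  simpa only [dotL_single] using (h.hasFDerivAt x).hasLineDerivAt (EuclideanSpace.single i 1)

theorem hasLineDerivAt_fst (h : HasPureSecondDerivs u a b) (i : Fin N) (x : Space N) :
    HasLineDerivAt ℝ (a i) (b i x) x (EuclideanSpace.single i 1) := by
  simpa only [h.fderiv_single] using
    (h.differentiable i x).hasFDerivAt.hasLineDerivAt (EuclideanSpace.single i 1)

theorem comp_affine (h : HasPureSecondDerivs u a b) (x : Space N) (r : ℝ) :
    HasPureSecondDerivs (fun y => u (x + r • y)) (fun i y => r * a i (x + r • y))
      (fun i y => r ^ 2 * b i (x + r • y)) := by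
  have haff : ∀ y : Space N, HasFDerivAt (fun y : Space N => x + r • y)
      (r • ContinuousLinearMap.id ℝ (Space N)) y := fun y =>
    ((hasFDerivAt_id y).const_smul r).const_add x
  refine ⟨fun y => ?_, fun i => ?_, fun i y => ?_, fun i => ?_⟩
  · refine ((h.hasFDerivAt (x + r • y)).comp y (haff y)).congr_fderiv ?_
    ext z
    simp only [dotL_apply, ContinuousLinearMap.comp_apply, smul_apply,
      ContinuousLinearMap.id_apply, map_smul, smul_eq_mul, Finset.mul_sum]
    exact Finset.sum_congr rfl fun i _ => by ring
  · exact ((h.differentiable i).comp fun y => (haff y).differentiableAt).const_mul r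
  · have h1 := (((h.differentiable i (x + r • y)).hasFDerivAt).comp y (haff y)).const_mul r
    have h2 : fderiv ℝ (fun y => r * a i (x + r • y)) y = _ := h1.fderiv
    rw [h2]
    simp only [ContinuousLinearMap.comp_apply, smul_apply, ContinuousLinearMap.id_apply, map_smul,
      smul_eq_mul, h.fderiv_single]
    ring
  · have := h.continuous_snd i
    fun_prop

/-- Since `y_i η = -∂_i ζ`, integrating by parts moves a derivative onto `a i (τ • y)`, producing
`τ` times the Laplacian. As `ζ` is `C¹` with compact support, no boundary term appears. -/
theorem integral_ray_deriv (h : HasPureSecondDerivs u a b) (τ : ℝ) :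
    ∫ y : Space N, (∑ i, a i (τ • y) * y i) * etaKer y =
      ∫ y : Space N, τ * (∑ i, b i (τ • y)) * zetaKer y := by
  have hca := h.continuous_fst
  have hcb := h.continuous_snd
  have hce := continuous_etaKer (N := N)
  have hcz := continuous_zetaKer (N := N)
  have ibp : ∀ i : Fin N, ∫ y : Space N, a i (τ • y) * (-(y i * etaKer y)) =
      -∫ y : Space N, (τ * b i (τ • y)) * zetaKer y := fun i => by
    refine integral_mul_deriv_eq_neg (e := EuclideanSpace.single i 1) (by fun_prop) (by fun_prop)
      hcz (by fun_prop) hasCompactSupport_zetaKer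
      (hasCompactSupport_etaKer.mul_left.neg) (fun y => ?_) (fun y => ?_)
    · have h1 : HasFDerivAt (fun y : Space N => τ • y) (τ • ContinuousLinearMap.id ℝ (Space N)) y :=
        (hasFDerivAt_id y).const_smul τ
      have h2 := (((h.differentiable i (τ • y)).hasFDerivAt).comp y h1).hasLineDerivAt
        (EuclideanSpace.single i 1)
      have e : ((fderiv ℝ (a i) (τ • y)).comp (τ • ContinuousLinearMap.id ℝ (Space N)))
          (EuclideanSpace.single i 1) = τ * b i (τ • y) := by
        simp [h.fderiv_single]
      rw [e] at h2
      exact h2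
    · simpa only [dotL_single] using
        (hasFDerivAt_zetaKer y).hasLineDerivAt (EuclideanSpace.single i 1)
  have e1 : ∀ y : Space N, (∑ i, a i (τ • y) * y i) * etaKer y =
      ∑ i, a i (τ • y) * (y i * etaKer y) := fun y => by
    rw [Finset.sum_mul]; exact Finset.sum_congr rfl fun i _ => by ring
  have e2 : ∀ y : Space N, τ * (∑ i, b i (τ • y)) * zetaKer y =
      ∑ i, (τ * b i (τ • y)) * zetaKer y := fun y => by
    rw [Finset.mul_sum, Finset.sum_mul]
  simp only [e1, e2]
  rw [integral_finsetSum, integral_finsetSum]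
  · refine Finset.sum_congr rfl fun i _ => ?_
    have := ibp i
    simp only [mul_neg, integral_neg, neg_inj] at this
    exact this
  · intro i _
    exact Continuous.integrable_of_hasCompactSupport (by fun_prop)
      hasCompactSupport_zetaKer.mul_left
  · intro i _
    exact Continuous.integrable_of_hasCompactSupport (by fun_prop)
      hasCompactSupport_etaKer.mul_left.mul_left

theorem hasDerivAt_integral_ray (h : HasPureSecondDerivs u a b) (τ : ℝ) :
    HasDerivAt (fun τ : ℝ => ∫ y : Space N, u (τ • y) * etaKer y)
      (∫ y : Space N, (∑ i, a i (τ • y) * y i) * etaKer y) τ := by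
  have hcu := h.continuous
  have hca := h.continuous_fst
  have hce := continuous_etaKer (N := N)
  have hF' : Continuous fun z : ℝ × Space N =>
      (∑ i, a i (z.1 • z.2) * z.2 i) * etaKer z.2 := by fun_prop
  obtain ⟨C, hC⟩ := ((isCompact_closedBall τ 1).prod
    (isCompact_closedBall (0 : Space N) 1)).exists_bound_of_continuousOn hF'.continuousOn
  refine (hasDerivAt_integral_of_dominated_loc_of_deriv_le
    (F' := fun τ y => (∑ i, a i (τ • y) * y i) * etaKer y)
    (bound := (Metric.closedBall (0 : Space N) 1).indicator fun _ => C)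
    (Metric.ball_mem_nhds τ one_pos)
    (Eventually.of_forall fun τ' => ?_) ?_ ?_ (ae_of_all _ fun y τ' hτ' => ?_) ?_
    (ae_of_all _ fun y τ' _ => ?_)).2
  · exact (by fun_prop : Continuous fun y => u (τ' • y) * etaKer y).aestronglyMeasurable
  · exact Continuous.integrable_of_hasCompactSupport (by fun_prop)
      hasCompactSupport_etaKer.mul_left
  · exact (by fun_prop : Continuous fun y : Space N =>
      (∑ i, a i (τ • y) * y i) * etaKer y).aestronglyMeasurable
  · by_cases hy : y ∈ Metric.closedBall (0 : Space N) 1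
    · rw [indicator_of_mem hy]
      exact hC (τ', y) ⟨Metric.ball_subset_closedBall hτ', hy⟩
    · rw [indicator_of_notMem hy, etaKer_eq_zero hy, mul_zero, norm_zero]
  · refine (integrable_indicator_iff Metric.isClosed_closedBall.measurableSet).2 ?_
    exact integrableOn_const (isCompact_closedBall (0 : Space N) 1).measure_lt_top.ne
  · have h1 : HasDerivAt (fun τ : ℝ => τ • y) y τ' := by
      simpa using (hasDerivAt_id τ').smul_const y
    have h2 := ((h.hasFDerivAt (τ' • y)).comp_hasDerivAt τ' h1).mul_const (etaKer y)
    simpa only [dotL_apply, Function.comp_def] using h2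

/-- The weighted means `∫ u(τy) η(y) dy` join `u 0 * ∫ η` at `τ = 0` to the mean over the unit ball
at `τ = 1`; their derivative in `τ` is at most `K ∫ ζ`. -/
theorem abs_zero_mul_le (h : HasPureSecondDerivs u a b) {K : ℝ} (hK : ∀ x, |∑ i, b i x| ≤ K) :
    |u 0| * ∫ y : Space N, etaKer y ≤
      (∫ y : Space N, |u y| * etaKer y) + K * ∫ y : Space N, zetaKer y := by
  have hcu := h.continuous
  have hce := continuous_etaKer (N := N)
  set m : ℝ → ℝ := fun τ => ∫ y : Space N, u (τ • y) * etaKer y with hm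
  have hbound : ∀ τ ∈ Ico (0 : ℝ) 1,
      ‖∫ y : Space N, (∑ i, a i (τ • y) * y i) * etaKer y‖ ≤ K * ∫ y : Space N, zetaKer y := by
    intro τ hτ
    rw [h.integral_ray_deriv, ← integral_const_mul]
    refine norm_integral_le_of_norm_le
      ((continuous_zetaKer.integrable_of_hasCompactSupport hasCompactSupport_zetaKer).const_mul K)
      (ae_of_all _ fun y => ?_)
    rw [norm_mul, norm_mul, Real.norm_eq_abs, Real.norm_eq_abs, Real.norm_eq_abs,
      abs_of_nonneg hτ.1, abs_of_nonneg (zetaKer_nonneg y)]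
    refine mul_le_mul_of_nonneg_right ?_ (zetaKer_nonneg y)
    have h1 := hK (τ • y)
    nlinarith [abs_nonneg (∑ i, b i (τ • y)), hτ.2, hτ.1]
  have hmv := norm_image_sub_le_of_norm_deriv_le_segment_01'
    (fun τ _ => (h.hasDerivAt_integral_ray τ).hasDerivWithinAt) hbound
  have h0 : (∫ y : Space N, u ((0 : ℝ) • y) * etaKer y) = u 0 * ∫ y : Space N, etaKer y := by
    simp only [zero_smul, integral_const_mul]
  have h1 : |∫ y : Space N, u ((1 : ℝ) • y) * etaKer y| ≤ ∫ y : Space N, |u y| * etaKer y := by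
    simp only [one_smul]
    refine (abs_integral_le_integral_abs).trans (le_of_eq ?_)
    exact integral_congr_ae (ae_of_all _ fun y => by
      simp only [abs_mul, abs_of_nonneg (etaKer_nonneg y)])
  rw [h0, Real.norm_eq_abs] at hmv
  have h2 : |u 0| * ∫ y : Space N, etaKer y = |u 0 * ∫ y : Space N, etaKer y| := by
    rw [abs_mul, abs_of_pos integral_etaKer_pos]
  rw [h2]
  have h3 := abs_sub_abs_le_abs_sub (u 0 * ∫ y : Space N, etaKer y)
    (∫ y : Space N, u ((1 : ℝ) • y) * etaKer y)
  rw [abs_sub_comm] at h3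
  linarith

end HasPureSecondDerivs

theorem exists_mean_value_const (N : ℕ) : ∃ C : ℝ, 0 < C ∧
    ∀ (u : Space N → ℝ) (a b : Fin N → Space N → ℝ), HasPureSecondDerivs u a b →
      ∀ K : ℝ, (∀ x, |∑ i, b i x| ≤ K) → ∀ (x : Space N) (r : ℝ),
        |u x| ≤ C * ((∫ y in Metric.closedBall (0 : Space N) 1, |u (x + r • y)|) + r ^ 2 * K) := by
  set I := ∫ y : Space N, etaKer y with hI
  set J := ∫ y : Space N, zetaKer y with hJ
  have hIpos : 0 < I := integral_etaKer_pos
  have hJ0 : 0 ≤ J := integral_nonneg zetaKer_nonneg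
  refine ⟨(4 + J) / I, by positivity, fun u a b h K hK x r => ?_⟩
  have hK0 : 0 ≤ K := (abs_nonneg _).trans (hK 0)
  have h1 := (h.comp_affine x r).abs_zero_mul_le (K := r ^ 2 * K) fun y => by
    rw [← Finset.mul_sum, abs_mul, abs_of_nonneg (sq_nonneg r)]
    exact mul_le_mul_of_nonneg_left (hK _) (sq_nonneg r)
  have hcu := h.continuous
  have hce := continuous_etaKer (N := N)
  have h2 : ∫ y : Space N, |u (x + r • y)| * etaKer y ≤
      4 * ∫ y in Metric.closedBall (0 : Space N) 1, |u (x + r • y)| := by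
    rw [← setIntegral_eq_integral_of_forall_compl_eq_zero
      (s := Metric.closedBall (0 : Space N) 1), ← integral_const_mul]
    · refine setIntegral_mono_on ?_ ?_ Metric.isClosed_closedBall.measurableSet fun y _ => ?_
      · exact (by fun_prop : Continuous fun y => |u (x + r • y)| * etaKer y).continuousOn
          |>.integrableOn_compact (isCompact_closedBall _ _)
      · exact (by fun_prop : Continuous fun y => 4 * |u (x + r • y)|).continuousOn
          |>.integrableOn_compact (isCompact_closedBall _ _)
      · rw [mul_comm]
        exact mul_le_mul_of_nonneg_right (etaKer_le y) (abs_nonneg _)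
    · intro y hy
      rw [etaKer_eq_zero hy, mul_zero]
  have hS : 0 ≤ ∫ y in Metric.closedBall (0 : Space N) 1, |u (x + r • y)| :=
    integral_nonneg fun _ => abs_nonneg _
  rw [smul_zero, add_zero] at h1
  rw [div_mul_eq_mul_div, le_div_iff₀ hIpos]
  have hrK : 0 ≤ r ^ 2 * K := by positivity
  nlinarith [mul_nonneg hJ0 hS]

/-- The Hardy–Littlewood argument: a mean value inequality with exponent `1` and a bound in `L^q`
for some `q ≤ 1` imply a bound in `L^∞`. -/
theorem exists_sup_bound (hN : 0 < N) {C q H K : ℝ} (hC : 0 < C) (hq0 : 0 < q) (hq1 : q ≤ 1)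
    (hK : 0 ≤ K) : ∃ B : ℝ, ∀ u : Space N → ℝ, Continuous u →
      (∀ (x : Space N) (r : ℝ), |u x| ≤
        C * ((∫ y in Metric.closedBall (0 : Space N) 1, |u (x + r • y)|) + r ^ 2 * K)) →
      (∀ (x : Space N) (r : ℝ), 0 < r →
        ∫ y in Metric.closedBall (0 : Space N) 1, |u (x + r • y)| ^ q ≤ H / r ^ N) →
      ∀ x, |u x| ≤ B := by
  set a : ℝ := N / q with ha
  have hNr : (0 : ℝ) < N := by exact_mod_cast hN
  have ha0 : 0 < a := by positivity
  have haq : a * q = N := by rw [ha]; field_simp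
  set C₃ := C * (2 ^ a * H + K) with hC₃
  refine ⟨max 1 (C₃ ^ (1 / q)), fun u hu hmv hL x₀ => ?_⟩
  -- The weight vanishes on the boundary of the ball, so a maximum point controls `u` on a ball
  -- around it of half its distance to the boundary. The exponent `a = N / q` makes all powers of
  -- that radius cancel in `hcalc`.
  set W : Space N → ℝ := fun x => (1 - ‖x - x₀‖) ^ a * |u x| with hW
  have hWc : ContinuousOn W (Metric.closedBall x₀ 1) := by
    have : Continuous W := by
      refine Continuous.mul (Continuous.rpow_const (by fun_prop) fun _ => Or.inr ha0.le) (by fun_prop)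
    exact this.continuousOn
  obtain ⟨x, hx, hmax⟩ := (isCompact_closedBall x₀ 1).exists_isMaxOn
    ⟨x₀, Metric.mem_closedBall_self zero_le_one⟩ hWc
  set M := W x with hM
  have hu0 : |u x₀| ≤ M := by
    have := hmax (Metric.mem_closedBall_self zero_le_one : x₀ ∈ Metric.closedBall x₀ 1)
    simpa [hW] using this
  refine hu0.trans ?_
  -- Once `M > 1`, the term with `K` is absorbed because `M ^ (1 - q) ≥ 1`, leaving `M ≤ C₃ * M ^ (1
  -- - q)`.
  rcases le_or_gt M 1 with hM1 | hM1
  · exact hM1.trans (le_max_left _ _)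
  refine le_trans ?_ (le_max_right _ _)
  have hMpos : 0 < M := one_pos.trans hM1
  set d := 1 - ‖x - x₀‖ with hd
  have hd0 : 0 ≤ d := by
    have : ‖x - x₀‖ ≤ 1 := by simpa [dist_eq_norm] using hx
    linarith
  have hMd : M = d ^ a * |u x| := rfl
  have hdpos : 0 < d := by
    rcases hd0.lt_or_eq with h | h
    · exact h
    · rw [hMd, ← h, Real.zero_rpow ha0.ne', zero_mul] at hMpos
      exact absurd hMpos (lt_irrefl _)
  have hd1 : d ≤ 1 := by linarith [norm_nonneg (x - x₀)]
  set r := d / 2 with hr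
  have hrpos : 0 < r := by positivity
  set L := M * r ^ (-a) with hLdef
  have hLpos : 0 < L := by positivity
  have hz : ∀ y ∈ Metric.closedBall (0 : Space N) 1, |u (x + r • y)| ≤ L := by
    intro y hy
    have hy1 : ‖y‖ ≤ 1 := by simpa using hy
    have h1 : ‖x + r • y - x₀‖ ≤ 1 - r := by
      have : x + r • y - x₀ = (x - x₀) + r • y := by abel
      rw [this]
      refine (norm_add_le _ _).trans ?_
      rw [norm_smul, Real.norm_of_nonneg hrpos.le]
      nlinarith
    have h2 : W (x + r • y) ≤ M := hmax (show x + r • y ∈ Metric.closedBall x₀ 1 by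
      rw [Metric.mem_closedBall, dist_eq_norm]; linarith)
    have h3 : r ^ a ≤ (1 - ‖x + r • y - x₀‖) ^ a :=
      Real.rpow_le_rpow hrpos.le (by linarith) ha0.le
    rw [hLdef, Real.rpow_neg hrpos.le, ← div_eq_mul_inv, le_div_iff₀ (by positivity), mul_comm]
    exact (mul_le_mul_of_nonneg_right h3 (abs_nonneg _)).trans h2
  have hint : ∫ y in Metric.closedBall (0 : Space N) 1, |u (x + r • y)| ≤
      L ^ (1 - q) * (H / r ^ N) := by
    refine le_trans ?_ (mul_le_mul_of_nonneg_left (hL x r hrpos) (by positivity))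
    rw [← integral_const_mul]
    refine setIntegral_mono_on ?_ ?_ Metric.isClosed_closedBall.measurableSet fun y hy => ?_
    · exact (by fun_prop : Continuous fun y => |u (x + r • y)|).continuousOn
          |>.integrableOn_compact (isCompact_closedBall _ _)
    · exact (Continuous.mul continuous_const (Continuous.rpow_const (by fun_prop)
        fun _ => Or.inr hq0.le)).continuousOn.integrableOn_compact (isCompact_closedBall _ _)
    · rcases (abs_nonneg (u (x + r • y))).lt_or_eq with h0 | h0
      · calc |u (x + r • y)| = |u (x + r • y)| ^ (1 - q) * |u (x + r • y)| ^ q := by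
              rw [← Real.rpow_add h0, sub_add_cancel, Real.rpow_one]
          _ ≤ L ^ (1 - q) * |u (x + r • y)| ^ q := by
              exact mul_le_mul_of_nonneg_right (Real.rpow_le_rpow h0.le (hz y hy) (by linarith))
                (by positivity)
      · rw [← h0]; positivity
  have hcalc : d ^ a * (L ^ (1 - q) * (H / r ^ N)) = 2 ^ a * H * M ^ (1 - q) := by
    have e1 : L ^ (1 - q) = M ^ (1 - q) * r ^ (-a * (1 - q)) := by
      rw [hLdef, Real.mul_rpow hMpos.le (by positivity), ← Real.rpow_mul hrpos.le]
    have e2 : d ^ a = 2 ^ a * r ^ a := by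
      rw [← Real.mul_rpow (by norm_num) hrpos.le, hr]; congr 1; ring
    have e3 : H / r ^ N = H * r ^ (-(N : ℝ)) := by
      rw [Real.rpow_neg hrpos.le, Real.rpow_natCast, div_eq_mul_inv]
    have e4 : r ^ a * r ^ (-a * (1 - q)) * r ^ (-(N : ℝ)) = 1 := by
      rw [← Real.rpow_add hrpos, ← Real.rpow_add hrpos]
      have : a + -a * (1 - q) + -(N : ℝ) = 0 := by rw [← haq]; ring
      rw [this, Real.rpow_zero]
    rw [e1, e2, e3]
    linear_combination 2 ^ a * H * M ^ (1 - q) * e4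
  have hMq1 : 1 ≤ M ^ (1 - q) := Real.one_le_rpow hM1.le (by linarith)
  have hfin : M ≤ C₃ * M ^ (1 - q) := by
    have h1 : M ≤ d ^ a * (C * (L ^ (1 - q) * (H / r ^ N) + r ^ 2 * K)) := by
      rw [hMd]
      refine mul_le_mul_of_nonneg_left ((hmv x r).trans ?_) (by positivity)
      gcongr
    have h2 : d ^ a * (r ^ 2 * K) ≤ K * M ^ (1 - q) := by
      have h3 : d ^ a ≤ 1 := Real.rpow_le_one hd0 hd1 ha0.le
      have h4 : r ^ 2 ≤ 1 := by nlinarith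
      calc d ^ a * (r ^ 2 * K) ≤ 1 * (1 * K) := by gcongr
        _ ≤ K * M ^ (1 - q) := by nlinarith
    calc M ≤ _ := h1
      _ = C * (d ^ a * (L ^ (1 - q) * (H / r ^ N)) + d ^ a * (r ^ 2 * K)) := by ring
      _ ≤ C * (2 ^ a * H * M ^ (1 - q) + K * M ^ (1 - q)) := by rw [hcalc]; gcongr
      _ = C₃ * M ^ (1 - q) := by rw [hC₃]; ring
  have hMq : M ^ q ≤ C₃ := by
    have e : M = M ^ q * M ^ (1 - q) := by
      rw [← Real.rpow_add hMpos]; simp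
    have hp : 0 < M ^ (1 - q) := by positivity
    refine le_of_mul_le_mul_right ?_ hp
    rw [← e]
    exact hfin
  calc M = (M ^ q) ^ (1 / q) := by
        rw [← Real.rpow_mul hMpos.le, mul_one_div_cancel hq0.ne', Real.rpow_one]
    _ ≤ C₃ ^ (1 / q) := Real.rpow_le_rpow (by positivity) hMq (by positivity)

/-! ### Pressure in a Hardy space -/

theorem hasPureSecondDerivs_corr (g : Tempered N) (θ : 𝓢(Space N, ℝ)) :
    HasPureSecondDerivs (corr g θ) (fun i x => -corr g (pd i θ) x)
      (fun i x => corr g (pd i (pd i θ)) x) := by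
  refine ⟨hasFDerivAt_corr g θ, fun i x => (hasFDerivAt_corr g (pd i θ) x).differentiableAt.neg,
    fun i x => ?_, fun i => continuous_corr g _⟩
  have h := ((hasFDerivAt_corr g (pd i θ) x).neg).fderiv
  have h' : fderiv ℝ (fun x => -corr g (pd i θ) x) x = _ := h
  rw [h', neg_apply, dotL_single, neg_neg]

theorem sum_corr_eq (g : Tempered N) (θ : 𝓢(Space N, ℝ)) (x : Space N) :
    ∑ i, corr g (pd i (pd i θ)) x = corr g (lap θ) x := by
  simp only [corr, lap, map_sum]

/-- Two integrations by parts in each coordinate; the compact support of `η` removes any need for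
growth bounds on `u`. -/
theorem HasPureSecondDerivs.integral_mul_lap {u : Space N → ℝ} {a b : Fin N → Space N → ℝ}
    (h : HasPureSecondDerivs u a b) {η : 𝓢(Space N, ℝ)} (hη : HasCompactSupport η) :
    ∫ x, u x * lap η x = ∫ x, (∑ i, b i x) * η x := by
  have hline : ∀ (ψ : 𝓢(Space N, ℝ)) (i : Fin N) (x : Space N),
      HasLineDerivAt ℝ ψ (pd i ψ x) x (EuclideanSpace.single i 1) := fun ψ i x => by
    rw [pd_apply]; exact (ψ.hasFDerivAt x).hasLineDerivAt _
  have key : ∀ i, ∫ x, u x * pd i (pd i η) x = ∫ x, b i x * η x := fun i => by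
    rw [integral_mul_deriv_eq_neg h.continuous (h.continuous_fst i) (pd i η).continuous
      (pd i (pd i η)).continuous (hasCompactSupport_pd hη i)
      (hasCompactSupport_pd (hasCompactSupport_pd hη i) i) (h.hasLineDerivAt i) (hline _ i),
      integral_mul_deriv_eq_neg (h.continuous_fst i) (h.continuous_snd i) η.continuous
      (pd i η).continuous hη (hasCompactSupport_pd hη i) (h.hasLineDerivAt_fst i) (hline _ i),
      neg_neg]
  have e1 : ∀ x, u x * lap η x = ∑ i, u x * pd i (pd i η) x := fun x => by
    simp only [lap, sum_apply, Finset.mul_sum]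
  simp only [e1, Finset.sum_mul]
  rw [integral_finsetSum, integral_finsetSum]
  · exact Finset.sum_congr rfl fun i _ => key i
  · intro i _
    exact ((h.continuous_snd i).mul η.continuous).integrable_of_hasCompactSupport hη.mul_left
  · intro i _
    exact (h.continuous.mul (pd i (pd i η)).continuous).integrable_of_hasCompactSupport
      (hasCompactSupport_pd (hasCompactSupport_pd hη i) i).mul_left

/-! ### Hardy bounds for the rescaled correlations. -/

theorem lintegral_comp_smul_eq (h : Space N → ℝ≥0∞) {s : ℝ} (hs : 0 < s) :
    ∫⁻ x, h (s • x) = ENNReal.ofReal (s ^ N)⁻¹ * ∫⁻ x, h x := by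
  -- Changing variables by a measurable equivalence needs no measurability of `h`, so the maximal
  -- function may be inserted directly.
  have e : ∫⁻ x, h (s • x) = ∫⁻ y, h y ∂(Measure.map (s • · : Space N → Space N) volume) :=
    (lintegral_map_equiv h (Homeomorph.smulOfNeZero s hs.ne').toMeasurableEquiv).symm
  rw [e, Measure.map_addHaar_smul volume hs.ne', lintegral_smul_measure, finrank_euclideanSpace_fin,
    abs_of_pos (by positivity), smul_eq_mul]

/-- The dilated functionals `ψ ↦ ⟨f, ψ(· / (n + 1))⟩`. -/
def dilTempered (f : Tempered N) (n : ℕ) : Tempered N :=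
  f.comp (dil ((n : ℝ) + 1)⁻¹ (by positivity))

/-- The reflection `dil (-1)` turns correlation into convolution, so this quantity is bounded by `(n
+ 1) ^ N` times the maximal function at `(n + 1) • x`. -/
theorem corr_dilTempered (φ : 𝓢(Space N, ℝ)) (f : Tempered N) (n : ℕ) (x : Space N) :
    corr (dilTempered f n) (dil (-1) (by norm_num) φ) x =
      ((n : ℝ) + 1) ^ N *
        f (dilatedKernel φ ((n : ℝ) + 1) (by positivity) (((n : ℝ) + 1) • x)) := by
  have hn : ((n : ℝ) + 1) ≠ 0 := by positivity
  rw [← smul_eq_mul, ← map_smul]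
  unfold corr dilTempered
  rw [ContinuousLinearMap.comp_apply]
  congr 1
  ext y
  rw [smul_apply, dilatedKernel_apply, smul_eq_mul, mul_inv_cancel_left₀ (by positivity), dil_apply,
    SchwartzMap.compSubConstCLM_apply, dil_apply, smul_sub, smul_sub, inv_smul_smul₀ hn]
  congr 1
  rw [← smul_sub, neg_one_smul, neg_sub]

/-- The measure with density `(𝓜_φ f)^q`. -/
def hardyMeasure (φ : 𝓢(Space N, ℝ)) (q : ℝ) (f : Tempered N) : Measure (Space N) :=
  volume.withDensity fun x => maximalFunction φ f x ^ q

theorem isFiniteMeasure_hardyMeasure {φ : 𝓢(Space N, ℝ)} {q : ℝ} (hq : 0 < q) {f : Tempered N}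
    (hf : f ∈ hardySpace φ q) : IsFiniteMeasure (hardyMeasure φ q f) := by
  refine ⟨?_⟩
  rw [hardyMeasure, withDensity_apply _ MeasurableSet.univ, Measure.restrict_univ]
  have h : (∫⁻ x, maximalFunction φ f x ^ q) ^ (1 / q) < ∞ := hf
  exact (ENNReal.rpow_lt_top_iff_of_pos (by positivity)).1 h

/-- With `s = n + 1`, the normalisation contributes `s ^ (N q)` and the change of variables `s ^
(-N)`; their product is at most `1` because `q ≤ 1 ≤ s`. The region is pushed out to `‖x‖ ≥ s ρ`,
which gives decay in `n` when `ρ > 0`. -/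
theorem setLIntegral_corr_rpow_le (φ : 𝓢(Space N, ℝ)) {q : ℝ} (hq0 : 0 < q) (hq1 : q ≤ 1)
    (f : Tempered N) (n : ℕ) (ρ : ℝ) :
    ∫⁻ x in {x | ρ ≤ ‖x‖},
        ENNReal.ofReal (|corr (dilTempered f n) (dil (-1) (by norm_num) φ) x| ^ q) ≤
      hardyMeasure φ q f {x | ((n : ℝ) + 1) * ρ ≤ ‖x‖} := by
  set s : ℝ := (n : ℝ) + 1 with hs
  have hs0 : 0 < s := by positivity
  have hs1 : 1 ≤ s := by rw [hs]; linarith [(Nat.cast_nonneg n : (0 : ℝ) ≤ n)]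
  have hm : ∀ ρ : ℝ, MeasurableSet {x : Space N | ρ ≤ ‖x‖} := fun ρ =>
    (isClosed_le continuous_const continuous_norm).measurableSet
  rw [hardyMeasure, withDensity_apply _ (hm _), ← lintegral_indicator (hm _),
    ← lintegral_indicator (hm _)]
  set h : Space N → ℝ≥0∞ :=
    {x | s * ρ ≤ ‖x‖}.indicator fun x => maximalFunction φ f x ^ q with hh
  have hpt : ∀ x, {x | ρ ≤ ‖x‖}.indicator (fun x =>
      ENNReal.ofReal (|corr (dilTempered f n) (dil (-1) (by norm_num) φ) x| ^ q)) x ≤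
      ENNReal.ofReal (s ^ N) ^ q * h (s • x) := by
    intro x
    by_cases hx : ρ ≤ ‖x‖
    · have hx' : s • x ∈ {x : Space N | s * ρ ≤ ‖x‖} := by
        change s * ρ ≤ ‖s • x‖
        rw [norm_smul, Real.norm_of_nonneg hs0.le]
        exact mul_le_mul_of_nonneg_left hx hs0.le
      rw [indicator_of_mem (show x ∈ {x : Space N | ρ ≤ ‖x‖} from hx), hh, indicator_of_mem hx',
        ← ENNReal.mul_rpow_of_nonneg _ _ hq0.le,
        ← ENNReal.ofReal_rpow_of_nonneg (abs_nonneg _) hq0.le]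
      refine ENNReal.rpow_le_rpow ?_ hq0.le
      rw [corr_dilTempered, abs_mul, abs_of_pos (by positivity : 0 < s ^ N),
        ENNReal.ofReal_mul (by positivity)]
      gcongr
      exact le_iSup₂ (f := fun (s : ℝ) (hs : 0 < s) =>
        ENNReal.ofReal |f (dilatedKernel φ s hs (((n : ℝ) + 1) • x))|) s hs0
    · rw [indicator_of_notMem (show x ∉ {x : Space N | ρ ≤ ‖x‖} from hx)]
      exact zero_le
  refine (lintegral_mono hpt).trans ?_
  rw [lintegral_const_mul' _ _ (ENNReal.rpow_ne_top_of_nonneg hq0.le ENNReal.ofReal_ne_top),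
    lintegral_comp_smul_eq h hs0, ← mul_assoc]
  refine mul_le_of_le_one_left zero_le ?_
  rw [ENNReal.ofReal_rpow_of_nonneg (by positivity) hq0.le, ← ENNReal.ofReal_mul (by positivity),
    ENNReal.ofReal_le_one, ← div_eq_mul_inv, div_le_one (by positivity)]
  have h1 : 1 ≤ s ^ N := one_le_pow₀ hs1
  calc (s ^ N) ^ q ≤ (s ^ N) ^ (1 : ℝ) := Real.rpow_le_rpow_of_exponent_le h1 hq1
    _ = s ^ N := Real.rpow_one _

theorem integrable_corr_rpow {φ : 𝓢(Space N, ℝ)} {q : ℝ} (hq0 : 0 < q) (hq1 : q ≤ 1)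
    {f : Tempered N} (hf : f ∈ hardySpace φ q) (n : ℕ) :
    Integrable fun x => |corr (dilTempered f n) (dil (-1) (by norm_num) φ) x| ^ q := by
  have := isFiniteMeasure_hardyMeasure hq0 hf
  have hc : Continuous fun x => |corr (dilTempered f n) (dil (-1) (by norm_num) φ) x| ^ q :=
    Continuous.rpow_const (continuous_corr _ _).abs fun _ => Or.inr hq0.le
  refine ⟨hc.aestronglyMeasurable, ?_⟩
  rw [hasFiniteIntegral_iff_ofReal (ae_of_all _ fun x => by positivity)]
  have h := setLIntegral_corr_rpow_le φ hq0 hq1 f n 0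
  have hu : {x : Space N | (0 : ℝ) ≤ ‖x‖} = univ := eq_univ_of_forall fun x => norm_nonneg x
  rw [hu, Measure.restrict_univ] at h
  exact h.trans_lt (measure_lt_top _ _)

theorem setIntegral_corr_rpow_le {φ : 𝓢(Space N, ℝ)} {q : ℝ} (hq0 : 0 < q) (hq1 : q ≤ 1)
    {f : Tempered N} (hf : f ∈ hardySpace φ q) (n : ℕ) (ρ : ℝ) :
    ∫ x in {x | ρ ≤ ‖x‖}, |corr (dilTempered f n) (dil (-1) (by norm_num) φ) x| ^ q ≤
      (hardyMeasure φ q f).real {x | ((n : ℝ) + 1) * ρ ≤ ‖x‖} := by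
  have := isFiniteMeasure_hardyMeasure hq0 hf
  rw [integral_eq_lintegral_of_nonneg_ae (ae_of_all _ fun x => by positivity)
    (integrable_corr_rpow hq0 hq1 hf n).aestronglyMeasurable.restrict]
  exact ENNReal.toReal_mono (measure_ne_top _ _) (setLIntegral_corr_rpow_le φ hq0 hq1 f n ρ)

theorem setIntegral_ball_corr_rpow_le {φ : 𝓢(Space N, ℝ)} {q : ℝ} (hq0 : 0 < q) (hq1 : q ≤ 1)
    {f : Tempered N} (hf : f ∈ hardySpace φ q) (n : ℕ) (x : Space N) (r : ℝ) (hr : 0 < r) :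
    ∫ y in Metric.closedBall (0 : Space N) 1,
        |corr (dilTempered f n) (dil (-1) (by norm_num) φ) (x + r • y)| ^ q ≤
      (hardyMeasure φ q f).real univ / r ^ N := by
  have hint := integrable_corr_rpow hq0 hq1 hf n
  set U : Space N → ℝ := fun x => |corr (dilTempered f n) (dil (-1) (by norm_num) φ) x| ^ q with hU
  have hU0 : ∀ x, 0 ≤ U x := fun x => by positivity
  have h1 : Integrable fun y => U (x + r • y) := (hint.comp_add_left x).comp_smul hr.ne'
  have h2 : ∫ y, U (x + r • y) = (r ^ N)⁻¹ * ∫ y, U y := by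
    rw [Measure.integral_comp_smul volume (fun y => U (x + y)) r, finrank_euclideanSpace_fin,
      abs_of_pos (by positivity), smul_eq_mul, integral_add_left_eq_self]
  have h3 : ∫ y, U y ≤ (hardyMeasure φ q f).real univ := by
    have h := setIntegral_corr_rpow_le hq0 hq1 hf n 0
    have hu : ∀ a : ℝ, {x : Space N | a * 0 ≤ ‖x‖} = univ := fun a =>
      eq_univ_of_forall fun x => by simp
    have hu' : {x : Space N | (0 : ℝ) ≤ ‖x‖} = univ := eq_univ_of_forall fun x => norm_nonneg x
    rwa [hu, hu', Measure.restrict_univ] at h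
  calc ∫ y in Metric.closedBall (0 : Space N) 1, U (x + r • y)
      ≤ ∫ y, U (x + r • y) := setIntegral_le_integral h1 (ae_of_all _ fun y => hU0 _)
    _ ≤ _ := by
      rw [h2, div_eq_inv_mul]
      exact mul_le_mul_of_nonneg_left h3 (by positivity)

theorem tendsto_hardyMeasure_tail {φ : 𝓢(Space N, ℝ)} {q : ℝ} (hq0 : 0 < q)
    {f : Tempered N} (hf : f ∈ hardySpace φ q) {ρ : ℝ} (hρ : 0 < ρ) :
    Tendsto (fun n : ℕ => (hardyMeasure φ q f).real {x | ((n : ℝ) + 1) * ρ ≤ ‖x‖}) atTop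
      (𝓝 0) := by
  have := isFiniteMeasure_hardyMeasure hq0 hf
  have h := tendsto_measure_iInter_atTop (μ := hardyMeasure φ q f)
    (s := fun n : ℕ => {x : Space N | ((n : ℝ) + 1) * ρ ≤ ‖x‖})
    (fun n => (isClosed_le continuous_const continuous_norm).measurableSet.nullMeasurableSet)
    (fun m n hmn x hx => le_trans (by gcongr) (show ((n : ℝ) + 1) * ρ ≤ ‖x‖ from hx))
    ⟨0, measure_ne_top _ _⟩
  have hempty : (⋂ n : ℕ, {x : Space N | ((n : ℝ) + 1) * ρ ≤ ‖x‖}) = ∅ := by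
    refine eq_empty_of_forall_notMem fun x hx => ?_
    obtain ⟨n, hn⟩ := exists_nat_gt (‖x‖ / ρ)
    have h1 : ((n : ℝ) + 1) * ρ ≤ ‖x‖ := mem_iInter.1 hx n
    rw [div_lt_iff₀ hρ] at hn
    linarith
  rw [hempty, measure_empty] at h
  exact (ENNReal.tendsto_toReal ENNReal.zero_ne_top).comp h

theorem abs_le_rpow_mul {q B z : ℝ} (hq1 : q ≤ 1) (hz : |z| ≤ B) :
    |z| ≤ B ^ (1 - q) * |z| ^ q := by
  rcases (abs_nonneg z).lt_or_eq with h0 | h0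
  · calc |z| = |z| ^ (1 - q) * |z| ^ q := by
          rw [← Real.rpow_add h0, sub_add_cancel, Real.rpow_one]
      _ ≤ B ^ (1 - q) * |z| ^ q :=
          mul_le_mul_of_nonneg_right (Real.rpow_le_rpow h0.le hz (by linarith)) (by positivity)
  · rw [← h0] at hz ⊢
    positivity

/-- The uniform bound upgrades `L^q` to `L¹` through `|z| ≤ B ^ (1 - q) * |z| ^ q`, and the `L^q`
mass outside the ball of radius `ρ` is a tail of a finite measure. -/
theorem tendsto_integral_corr_mul {φ : 𝓢(Space N, ℝ)} {q : ℝ} (hq0 : 0 < q) (hq1 : q ≤ 1)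
    {f : Tempered N} (hf : f ∈ hardySpace φ q) {B : ℝ}
    (hB : ∀ n x, |corr (dilTempered f n) (dil (-1) (by norm_num) φ) x| ≤ B)
    (κ : 𝓢(Space N, ℝ)) {ρ : ℝ} (hρ : 0 < ρ) (hκ : ∀ x, ‖x‖ < ρ → κ x = 0) :
    Tendsto (fun n => ∫ x, corr (dilTempered f n) (dil (-1) (by norm_num) φ) x * κ x) atTop
      (𝓝 0) := by
  have hB0 : 0 ≤ B := (abs_nonneg _).trans (hB 0 0)
  set S := SchwartzMap.seminorm ℝ 0 0 κ with hS
  have hlim := (tendsto_hardyMeasure_tail hq0 hf hρ).const_mul (S * B ^ (1 - q))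
  rw [mul_zero] at hlim
  refine squeeze_zero_norm (fun n => ?_) hlim
  rw [← setIntegral_eq_integral_of_forall_compl_eq_zero (s := {x : Space N | ρ ≤ ‖x‖})
    (fun x hx => by rw [hκ x (not_le.1 hx), mul_zero])]
  refine le_trans ?_ (mul_le_mul_of_nonneg_left (setIntegral_corr_rpow_le hq0 hq1 hf n ρ)
    (by positivity))
  rw [← integral_const_mul]
  refine norm_integral_le_of_norm_le
    ((integrable_corr_rpow hq0 hq1 hf n).integrableOn.const_mul _) (ae_of_all _ fun x => ?_)
  rw [norm_mul, mul_comm, Real.norm_eq_abs (corr _ _ x), mul_assoc]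
  exact mul_le_mul (SchwartzMap.norm_le_seminorm ℝ κ x) (abs_le_rpow_mul hq1 (hB n x))
    (abs_nonneg _) (by positivity)

/-! ### Liouville argument at a fixed time. -/

/-- The constant-coefficient combination `∑ i j, c_ij ∂_i ∂_j θ`. -/
def hessComb (c : Fin N → Fin N → ℝ) (θ : 𝓢(Space N, ℝ)) : 𝓢(Space N, ℝ) :=
  ∑ i, ∑ j, c i j • pd i (pd j θ)

theorem hessComb_apply (c : Fin N → Fin N → ℝ) (θ : 𝓢(Space N, ℝ)) (x : Space N) :
    hessComb c θ x = ∑ i, ∑ j, c i j * pd i (pd j θ) x := by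
  simp only [hessComb, sum_apply, smul_apply, smul_eq_mul]

theorem integral_pd_pd_mul (i j : Fin N) (θ ψ : 𝓢(Space N, ℝ)) :
    ∫ x, pd i (pd j θ) x * ψ x = ∫ x, θ x * pd i (pd j ψ) x := by
  have h : ∀ (k : Fin N) (f g : 𝓢(Space N, ℝ)), ∫ x, f x * pd k g x = -∫ x, pd k f x * g x :=
    fun k f g => SchwartzMap.integral_mul_lineDerivOp_right_eq_neg_left f g _
  rw [h i θ, h j (pd i θ), neg_neg, pd_comm]

/-- Moving both derivatives onto widely dilated copies of `x_k²` computes a second moment, whose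
limit is `2 c_kk ∫ θ`. -/
theorem diag_eq_zero_of_hessComb_eq_zero {c : Fin N → Fin N → ℝ} {θ : 𝓢(Space N, ℝ)}
    (hθ : ∫ x, θ x ≠ 0) (h : ∀ᵐ x, hessComb c θ x = 0) (k : Fin N) : c k k = 0 := by
  have hw : ∀ i j, Integrable fun x => c i j * θ x := fun i j => θ.integrable.const_mul _
  have hz : ∀ ψ, hessPairing (fun i j x => c i j * θ x) ψ = 0 := fun ψ => by
    have h1 : ∀ i j, ∫ x, c i j * θ x * pd i (pd j ψ) x = ∫ x, c i j * pd i (pd j θ) x * ψ x := by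
      intro i j
      simp only [mul_assoc, integral_const_mul, integral_pd_pd_mul]
    have hi : ∀ i j, Integrable fun x => c i j * pd i (pd j θ) x * ψ x := fun i j =>
      integrable_mul_schwartz ((pd i (pd j θ)).integrable.const_mul _) ψ
    simp only [hessPairing, h1]
    simp only [← integral_finsetSum _ fun j _ => hi _ j]
    rw [← integral_finsetSum _ fun i _ => integrable_finsetSum _ fun j _ => hi i j]
    refine integral_eq_zero_of_ae ?_
    filter_upwards [h] with x hx
    simp only [← Finset.sum_mul, ← hessComb_apply, hx, zero_mul, Pi.zero_apply]
  have hlim := tendsto_hessPairing_dil hw (quadTest k k)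
  simp only [hz, mul_zero, integral_const_mul] at hlim
  have h0 := tendsto_nhds_unique tendsto_const_nhds hlim
  have h2 : ∀ i j : Fin N, pd i (pd j (quadTest k k)) 0 =
      if i = k then (if j = k then 2 else 0) else 0 := by
    intro i j
    rw [pd_pd_quadTest_zero]
    split_ifs <;> norm_num
  simp only [h2, mul_ite, mul_zero, Finset.sum_ite_irrel, Finset.sum_ite_eq', Finset.mem_univ,
    if_true, Finset.sum_const_zero] at h0
  rcases mul_eq_zero.1 h0.symm with h3 | h3
  · exact (mul_eq_zero.1 h3).resolve_right hθ
  · norm_num at h3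

theorem abs_sum_integral_le {w : Fin N → Fin N → Space N → ℝ} (hw : ∀ i j, Integrable (w i j))
    (θ : 𝓢(Space N, ℝ)) (c : ℝ) (x : Space N) :
    |∑ i, ∑ j, ∫ y, w i j y * pd i (pd j θ) (c • y - x)| ≤
      ∑ i, ∑ j, (∫ y, ‖w i j y‖) * SchwartzMap.seminorm ℝ 0 0 (pd i (pd j θ)) := by
  refine (Finset.abs_sum_le_sum_abs _ _).trans (Finset.sum_le_sum fun i _ => ?_)
  refine (Finset.abs_sum_le_sum_abs _ _).trans (Finset.sum_le_sum fun j _ => ?_)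
  rw [← Real.norm_eq_abs, ← integral_mul_const]
  refine norm_integral_le_of_norm_le ((hw i j).norm.mul_const _) (ae_of_all _ fun y => ?_)
  rw [norm_mul]
  gcongr
  exact SchwartzMap.norm_le_seminorm ℝ (pd i (pd j θ)) _

theorem diag_integral_eq_zero_of_mem_hardySpace (hN : 0 < N) {φ : 𝓢(Space N, ℝ)}
    (hφ : ∫ x, φ x ≠ 0) {q : ℝ} (hq0 : 0 < q) (hq1 : q ≤ 1) {f : Tempered N}
    (hf : f ∈ hardySpace φ q) {w : Fin N → Fin N → Space N → ℝ} (hw : ∀ i j, Integrable (w i j))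
    (hid : ∀ (n : ℕ) (x : Space N), corr (dilTempered f n) (lap (dil (-1) (by norm_num) φ)) x =
      -∑ i, ∑ j, ∫ y, w i j y *
        pd i (pd j (dil (-1) (by norm_num) φ)) (((n : ℝ) + 1)⁻¹ • y - x)) (k : Fin N) :
    ∫ x, w k k x = 0 := by
  have : Nonempty (Fin N) := ⟨⟨0, hN⟩⟩
  set θ : 𝓢(Space N, ℝ) := dil (-1) (by norm_num) φ with hθ
  have hθint : ∫ x, θ x ≠ 0 := by
    have : ∫ x, θ x = ∫ x, φ x := by
      simp only [hθ, dil_apply, neg_smul, one_smul]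
      exact integral_neg_eq_self φ volume
    rwa [this]
  set K := ∑ i, ∑ j, (∫ y, ‖w i j y‖) * SchwartzMap.seminorm ℝ 0 0 (pd i (pd j θ)) with hK
  have hFK : ∀ n x, |corr (dilTempered f n) (lap θ) x| ≤ K := fun n x => by
    rw [hid, abs_neg]; exact abs_sum_integral_le hw θ _ x
  have hK0 : 0 ≤ K := (abs_nonneg _).trans (hFK 0 0)
  obtain ⟨C, hC, hmv⟩ := exists_mean_value_const N
  obtain ⟨B, hB⟩ := exists_sup_bound hN (H := (hardyMeasure φ q f).real univ) hC hq0 hq1 hK0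
  have hub : ∀ n x, |corr (dilTempered f n) θ x| ≤ B := fun n =>
    hB _ (continuous_corr _ _)
      (hmv _ _ _ (hasPureSecondDerivs_corr _ _) K fun x => by rw [sum_corr_eq]; exact hFK n x)
      (setIntegral_ball_corr_rpow_le hq0 hq1 hf n)
  set c : Fin N → Fin N → ℝ := fun i j => ∫ y, w i j y with hc
  have hlimF : ∀ x, Tendsto (fun n => corr (dilTempered f n) (lap θ) x) atTop
      (𝓝 (-hessComb c θ (-x))) := fun x => by
    simp only [hid, hessComb_apply]
    exact (tendsto_finsetSum _ fun i _ => tendsto_finsetSum _ fun j _ =>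
      tendsto_integral_mul_dil (hw i j) _ _).neg
  have hFc : Continuous fun x => -hessComb c θ (-x) := by fun_prop
  -- For a test function supported away from the origin, the pairing with the Laplacians has two
  -- limits: `0`, after moving the Laplacian onto the test function, and the pairing with the
  -- pointwise limit.
  have hFae : ∀ᵐ x : Space N, x ∈ ({0}ᶜ : Set (Space N)) → -hessComb c θ (-x) = 0 := by
    refine isOpen_compl_singleton.ae_eq_zero_of_integral_contDiff_smul_eq_zero
      (hFc.locallyIntegrable.locallyIntegrableOn _) fun g hg hgc hgs => ?_
    set η : 𝓢(Space N, ℝ) := hgc.toSchwartzMap hg with hη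
    have hηg : (η : Space N → ℝ) = g := rfl
    obtain ⟨ρ, hρ, hball⟩ := Metric.isOpen_iff.1 (isClosed_tsupport g).isOpen_compl 0
      (fun h0 => hgs h0 rfl)
    have hlap0 : ∀ x, ‖x‖ < ρ → lap η x = 0 := fun x hx => by
      have hx' : x ∉ tsupport g := hball (by simpa using hx)
      simp only [lap, sum_apply]
      refine Finset.sum_eq_zero fun i _ => ?_
      refine image_eq_zero_of_notMem_tsupport fun h => hx' ?_
      exact SchwartzMap.tsupport_lineDerivOp_subset _ _
        (SchwartzMap.tsupport_lineDerivOp_subset _ _ h)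
    have h1 := tendsto_integral_corr_mul hq0 hq1 hf hub (lap η) hρ hlap0
    have h2 : Tendsto (fun n => ∫ x, corr (dilTempered f n) (lap θ) x * η x) atTop
        (𝓝 (∫ x, -hessComb c θ (-x) * η x)) := by
      refine tendsto_integral_of_dominated_convergence (fun x => K * ‖η x‖) (fun n => ?_)
        (η.integrable.norm.const_mul K) (fun n => ae_of_all _ fun x => ?_)
        (ae_of_all _ fun x => (hlimF x).mul_const _)
      · exact ((continuous_corr _ _).mul η.continuous).aestronglyMeasurable
      · rw [norm_mul]
        exact mul_le_mul_of_nonneg_right (hFK n x) (norm_nonneg _)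
    have h3 : ∀ n, ∫ x, corr (dilTempered f n) θ x * lap η x =
        ∫ x, corr (dilTempered f n) (lap θ) x * η x := fun n => by
      rw [(hasPureSecondDerivs_corr (dilTempered f n) θ).integral_mul_lap
        (show HasCompactSupport η from hgc)]
      simp only [sum_corr_eq]
    have h4 := tendsto_nhds_unique (h1.congr h3) h2
    rw [h4]
    exact integral_congr_ae (ae_of_all _ fun x => by rw [hηg]; simp [mul_comm])
  have hzero : ∀ᵐ x : Space N, hessComb c θ x = 0 := by
    have h0 : ∀ᵐ x : Space N, x ∈ ({0}ᶜ : Set (Space N)) :=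
      compl_mem_ae_iff.2 (measure_singleton _)
    have h1 : ∀ᵐ x : Space N, hessComb c θ (-x) = 0 := by
      filter_upwards [hFae, h0] with x hx hx0
      exact neg_eq_zero.1 (hx hx0)
    have h2 := (Measure.measurePreserving_neg (volume : Measure (Space N))).quasiMeasurePreserving.ae
      h1
    simpa using h2
  exact diag_eq_zero_of_hessComb_eq_zero hθint hzero k

theorem continuous_sum_integral_translate {w : Fin N → Fin N → Space N → ℝ}
    (hw : ∀ i j, Integrable (w i j)) (θ : 𝓢(Space N, ℝ)) (c : ℝ) :
    Continuous fun x : Space N => ∑ i, ∑ j, ∫ y, w i j y * pd i (pd j θ) (c • y - x) := by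
  refine continuous_finsetSum _ fun i _ => continuous_finsetSum _ fun j _ => ?_
  refine continuous_of_dominated (bound := fun y => ‖w i j y‖ *
    SchwartzMap.seminorm ℝ 0 0 (pd i (pd j θ))) (fun x => ?_) (fun x => ae_of_all _ fun y => ?_)
    ((hw i j).norm.mul_const _) (ae_of_all _ fun y => by fun_prop)
  · exact (hw i j).aestronglyMeasurable.mul (by fun_prop : Continuous fun y : Space N =>
      pd i (pd j θ) (c • y - x)).aestronglyMeasurable
  · rw [norm_mul]
    gcongr
    exact SchwartzMap.norm_le_seminorm ℝ (pd i (pd j θ)) _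

/-- This is the pressure identity for dilated translates of `θ`, with the common factor `(n + 1)⁻²`
cancelled. A single null set of times serves all `x` because the identity is imposed at a dense
sequence and both sides are continuous in `x`. -/
theorem ae_corr_lap_eq {ν T : ℝ} {v : ℝ → Space N → Space N}
    {p : ℝ → Tempered N} (hsol : IsWeakSolution ν T v p) (θ : 𝓢(Space N, ℝ)) :
    ∀ᵐ t ∂(timeMeasure T), ∀ (n : ℕ) (x : Space N), corr (dilTempered (p t) n) (lap θ) x =
      -∑ i, ∑ j, ∫ y, v t y i * v t y j * pd i (pd j θ) (((n : ℝ) + 1)⁻¹ • y - x) := by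
  have h := ae_all_iff.2 fun n : ℕ => ae_all_iff.2 fun m : ℕ => ae_hessPairing_eq hsol
    (dil ((n : ℝ) + 1)⁻¹ (by positivity)
      (SchwartzMap.compSubConstCLM ℝ (TopologicalSpace.denseSeq (Space N) m) θ))
  filter_upwards [h, ae_memLp_of_memL1Lq two_ne_zero (by simp) hsol.memL1L2] with t ht hv n
  have hw := integrable_mul_components hv
  have hn : ((n : ℝ) + 1) ≠ 0 := by positivity
  refine congrFun (Continuous.ext_on (TopologicalSpace.denseRange_denseSeq (Space N))
    (continuous_corr _ _) (continuous_sum_integral_translate hw θ _).neg ?_)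
  rintro _ ⟨m, rfl⟩
  have h1 := ht n m
  rw [lap_dil, map_smul, lap_compSubConst] at h1
  have h2 : hessPairing (fun i j x => v t x i * v t x j) (dil ((n : ℝ) + 1)⁻¹ (by positivity)
      (SchwartzMap.compSubConstCLM ℝ (TopologicalSpace.denseSeq (Space N) m) θ)) =
      ((n : ℝ) + 1)⁻¹ ^ 2 * ∑ i, ∑ j, ∫ y, v t y i * v t y j *
        pd i (pd j θ) (((n : ℝ) + 1)⁻¹ • y - TopologicalSpace.denseSeq (Space N) m) := by
    simp only [hessPairing, Finset.mul_sum, ← integral_const_mul]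
    refine Finset.sum_congr rfl fun i _ => Finset.sum_congr rfl fun j _ =>
      integral_congr_ae (ae_of_all _ fun y => ?_)
    simp only [pd_pd_dil, pd_compSubConst, smul_apply, dil_apply, smul_eq_mul,
      SchwartzMap.compSubConstCLM_apply]
    ring
  rw [h2, smul_eq_mul, ← mul_neg] at h1
  have h3 := mul_left_cancel₀ (by positivity) h1
  exact (neg_eq_iff_eq_neg.2 h3).symm

/-! ### From vanishing energy to a vanishing velocity. -/

theorem ae_eq_zero_of_integral_sq_eq_zero {u : Space N → Space N} (hu : MemLp u 2 volume)
    (h : ∀ k, ∫ x, u x k * u x k = 0) : ∀ᵐ x, u x = 0 := by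
  have h1 : ∀ k, ∀ᵐ x, u x k * u x k = 0 := fun k =>
    (integral_eq_zero_iff_of_nonneg (fun x => mul_self_nonneg _)
      (integrable_mul_components hu k k)).1 (h k)
  filter_upwards [ae_all_iff.2 h1] with x hx
  ext k
  exact mul_self_eq_zero.1 (hx k)

theorem ae_prod_eq_zero {T : ℝ} {v : ℝ → Space N → Space N} (hv : MemL1Lq T 2 v)
    (h : ∀ᵐ t ∂(timeMeasure T), ∀ k, ∫ x, v t x k * v t x k = 0) :
    ∀ᵐ z ∂((timeMeasure T).prod (volume : Measure (Space N))), v z.1 z.2 = 0 := by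
  have : SFinite (timeMeasure T) := by unfold timeMeasure; infer_instance
  -- A strongly measurable representative makes `{g ≠ 0}` measurable, so its product measure can be
  -- tested slice by slice.
  obtain ⟨g, hg, hvg⟩ := hv.1
  have hslice : ∀ᵐ t ∂(timeMeasure T), ∀ᵐ x, v t x = g (t, x) := Measure.ae_ae_of_ae_prod hvg
  have hg0 : ∀ᵐ z ∂((timeMeasure T).prod (volume : Measure (Space N))), g z = 0 := by
    refine (Measure.measure_prod_null (hg.measurable (measurableSet_singleton 0).compl)).2 ?_
    filter_upwards [hslice, h, ae_memLp_of_memL1Lq two_ne_zero (by simp) hv] with t ht h0 hm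
    have hz := ae_eq_zero_of_integral_sq_eq_zero hm h0
    have : ∀ᵐ x, g (t, x) = 0 := by
      filter_upwards [ht, hz] with x h1 h2
      rw [← h1, h2]
    exact this
  filter_upwards [hvg, hg0] with z h1 h2
  exact h1.trans h2

end

end NavierStokes

open NavierStokes

theorem theorem1p1 (N : ℕ) (hN : 2 ≤ N) (T : ℝ) (hT : 0 < T) (ν : ℝ) (hν : 0 ≤ ν)
    (φ : 𝓢(Space N, ℝ)) (hφ : (∫ x, φ x) ≠ 0)
    (v : ℝ → Space N → Space N) (p : ℝ → Tempered N) (hsol : IsWeakSolution ν T v p) :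
    (((∃ P : ℝ → Space N → ℝ, IsL1L1Density T p P ∧
          ∀ᵐ t ∂(timeMeasure T), 0 ≤ ∫ x, P t x) ∨
        (∃ q : ℝ, 0 < q ∧ q ≤ 1 ∧ MemL1Hardy φ q T p)) →
      ∀ᵐ z ∂((timeMeasure T).prod (volume : Measure (Space N))), v z.1 z.2 = 0) ∧
    (∀ P : ℝ → Space N → ℝ, IsL1L1Density T p P →
      (∀ᵐ t ∂(timeMeasure T), (∫ x, P t x) ≤ 0) →
      ∀ᵐ t ∂(timeMeasure T),
        (∀ j, energy v j t = -(1 / 2) * ∫ x, P t x) ∧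
        (∀ j k, j ≠ k → (∫ x, v t x j * v t x k) = 0)) := by
  refine ⟨fun h => ae_prod_eq_zero hsol.memL1L2 ?_, fun P hP _ => ?_⟩
  · rcases h with ⟨P, hP, hpos⟩ | ⟨q, hq0, hq1, -, hmem, -⟩
    · filter_upwards [ae_stress_eq_pressure hsol hP, hpos] with t ht hp k
      have h1 := ht k k
      rw [if_pos rfl] at h1
      have h2 : 0 ≤ ∫ x, v t x k * v t x k := integral_nonneg fun x => mul_self_nonneg _
      linarith
    · filter_upwards [ae_corr_lap_eq hsol (dil (-1) (by norm_num) φ), hmem,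
        ae_memLp_of_memL1Lq two_ne_zero (by simp) hsol.memL1L2] with t ht hp hv
      exact diag_integral_eq_zero_of_mem_hardySpace (by omega) hφ hq0 hq1 hp
        (integrable_mul_components hv) ht
  · filter_upwards [ae_stress_eq_pressure hsol hP] with t ht
    refine ⟨fun j => ?_, fun j k hjk => ?_⟩
    · have h1 := ht j j
      rw [if_pos rfl] at h1
      simp only [energy, sq, h1]
      ring
    · rw [ht j k, if_neg hjk]
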